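/- Let $(m_i,n_i)_{i\ge 1}$ be a sequence of pairwise distinct pairs of natural numbers with $n_i\to\infty$, and let $d_L=d_L(i)\le d_R=d_R(i)$ be natural numbers such that, as $i\to\infty$: $d_R\to\infty$; $d_R=o(n_i^{\epsilon})$ for every fixed $\epsilon>0$; and $d_R/d_L\to y$, where $1\le y<\infty$. For each $i$ let $G_i$ be a random graph chosen uniformly from all $(d_L,d_R)$-biregular bipartite simple graphs with vertex classes $L,R$ of sizes $|L|=m_i$, $|R|=n_i$ (every vertex of $L$ has degree $d_L$, every vertex of $R$ has degree $d_R$, and all edges join $L$ to $R$); such graphs are assumed to exist. All $G_i$ are defined on one probability space, with an arbitrary joint distribution. Let $A_i$ be the adjacency matrix of $G_i$, and let $\mu_i$ be the empirical spectral distribution of $d_R^{-1/2}A_i$, that is, the uniform probability measure on its $m_i+n_i$ eigenvalues counted with multiplicity. Let $\beta_k(r,\sigma^2)$ be the $k$-th moment of the Marčenko–Pastur law with ratio $r>0$ and scale $\sigma^2>0$, i.e. the law with density $\frac{1}{2\pi x r\sigma^2}\sqrt{(b-x)(x-a)}$ on $[a,b]$, where $a=\sigma^2(1-\sqrt r)^2$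 and $b=\sigma^2(1+\sqrt r)^2$, and with an additional point mass $1-\frac1r$ at $0$ if $r>1$. Then, almost surely, $$\int x^{2k+1}\,d\mu_i(x)\to 0\quad (k\ge 0),\qquad \int x^{2k}\,d\mu_i(x)\to\frac{2}{1+y}\,\beta_k(y^{-1},1)\quad (k\ge 1)$$ as $i\to\infty$. Moreover, for every $k\ge1$, $$\beta_k(y^{-1},1)=\sum_{r=0}^{k-1}y^{-r}N(k,r),\qquad\text{where } N(k,r)=\frac{1}{r+1}\binom{k}{r}\binom{k-1}{r}$$ are the Narayana numbers. -/

import Mathlib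

namespace BiregularMP

open Classical in
/-- A simple graph with left class `L = Fin m` and right class `R = Fin n` is
`(dL, dR)`-biregular bipartite if all edges join `L` to `R`, every vertex of `L` has degree `dL`
and every vertex of `R` has degree `dR`. -/
structure IsBiregular {m n : ℕ} (dL dR : ℕ) (G : SimpleGraph (Fin m ⊕ Fin n)) : Prop where
  bipartite : G.IsBipartiteWith (Set.range Sum.inl) (Set.range Sum.inr)
  degree_left : ∀ u : Fin m, G.degree (Sum.inl u) = dL
  degree_right : ∀ v : Fin n, G.degree (Sum.inr v) = dR

/-- The uniform distribution on all `(dL, dR)`-biregular bipartite graphs with `|L| = m` and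
`|R| = n` (the zero measure if there is no such graph). -/
noncomputable def uniformBiregular (m n dL dR : ℕ) :
    MeasureTheory.Measure (SimpleGraph (Fin m ⊕ Fin n)) :=
  ProbabilityTheory.uniformOn {G | IsBiregular dL dR G}

/-- The empirical spectral distribution of a symmetric real matrix: the uniform distribution on
its eigenvalues, counted with multiplicity. -/
noncomputable def esd {V : Type*} [Fintype V] [DecidableEq V] {M : Matrix V V ℝ}
    (hM : M.IsHermitian) : MeasureTheory.Measure ℝ :=
  (Fintype.card V : ENNReal)⁻¹ • ∑ v, MeasureTheory.Measure.dirac (hM.eigenvalues v)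

open Classical in
/-- The matrix `d ^ (-1/2) A`, where `A` is the adjacency matrix of `G`. -/
noncomputable def scaledAdj {V : Type*} (d : ℕ) (G : SimpleGraph V) : Matrix V V ℝ :=
  (Real.sqrt d)⁻¹ • G.adjMatrix ℝ

theorem scaledAdj_isHermitian {V : Type*} (d : ℕ) (G : SimpleGraph V) :
    (scaledAdj d G).IsHermitian := by
  classical
  ext u v
  simp [scaledAdj, SimpleGraph.adjMatrix_apply, G.adj_comm]

/-- The Marčenko–Pastur law with ratio `r > 0` and scale `s = σ² > 0`: on `[a, b]`, where
`a = s (1 - √r)²` and `b = s (1 + √r)²`, it has the density `√((b - x) (x - a)) / (2 π x r s)`,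
and it has an additional point mass `1 - 1/r` at `0` if `r > 1`. -/
noncomputable def marcenkoPastur (r s : ℝ) : MeasureTheory.Measure ℝ :=
  ENNReal.ofReal (1 - 1 / r) • MeasureTheory.Measure.dirac 0 +
    (MeasureTheory.volume.restrict
      (Set.Icc (s * (1 - Real.sqrt r) ^ 2) (s * (1 + Real.sqrt r) ^ 2))).withDensity
      fun x => ENNReal.ofReal
        (Real.sqrt ((s * (1 + Real.sqrt r) ^ 2 - x) * (x - s * (1 - Real.sqrt r) ^ 2)) /
          (2 * Real.pi * x * r * s))

/-- `β_k(r, s)`, the `k`-th moment of the Marčenko–Pastur law with ratio `r` and scale `s`. -/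
noncomputable def mpMoment (k : ℕ) (r s : ℝ) : ℝ :=
  ∫ x, x ^ k ∂(marcenkoPastur r s)

/-- The Narayana number `N(k, a) = (k choose a) (k-1 choose a) / (a + 1)`, for `k ≥ 1`. -/
noncomputable def narayana (k a : ℕ) : ℝ :=
  1 / ((a : ℝ) + 1) * (k.choose a : ℝ) * ((k - 1).choose a : ℝ)

end BiregularMP

/-! A bipartite graph has no closed walks of odd length, so the odd moments vanish exactly. For the
even ones, the matrices `nbMatrix` of non-backtracking walk counts obey a three-term recurrence
under multiplication by `A`. By biregularity its coefficients, for walks that start in `R`, are `dR`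
at first and then alternate between `dL - 1` and `dR - 1`; divided by `dR` they tend to `1` and
`y⁻¹`. Unrolling the recurrence turns the normalised trace of `A ^ (2 * k)` into a weighted count of
lattice paths (`tendsto_nbTrace`), provided that closed non-backtracking walks are negligible in
number. The path count is a Narayana sum by reflection (`sum_narayana_of_recurrence`). The
Marčenko–Pastur moments satisfy the same recurrence after the substitution `x = 1 + s² + 2 s cos θ`
with `s² = y⁻¹` (`mpMoment_eq_sum_narayana`).

Closed non-backtracking walks are rare for the following reason. Pruning tails leaves cyclically
non-backtracking walks (`card_closedNB_le`), and a union of those has at least as many edges as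
vertices (`card_image_le_card_stepEdges`). Switching shows that `k` prescribed edges are all present
with probability at most `(2 dL / n) ^ k` (`card_biregularSets_superset_le`). Hence the tenth moment
of the number of such walks of fixed length is eventually at most `n`, the number exceeds `√n` with
probability at most `n⁻⁴`, and Borel–Cantelli applies. No independence is needed, so the joint law
of the graphs is irrelevant. -/

open Filter Topology

/-! ### Lattice path recurrences, reflection and Narayana numbers. -/

/-- `∑ s < M, c ^ (s + j) * choose a (s + j) * choose a s`, a weighted binomial autocorrelation. -/
noncomputable def chooseCorr (c : ℝ) (M a j : ℕ) : ℝ :=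
  ∑ s ∈ Finset.range M, c ^ (s + j) * (a.choose (s + j) : ℝ) * (a.choose s : ℝ)

theorem chooseCorr_eq_of_lt (c : ℝ) {M a : ℕ} (j : ℕ) (h : a < M) :
    chooseCorr c M a j = chooseCorr c (a + 1) a j := by
  unfold chooseCorr
  symm
  apply Finset.sum_subset
  · intro s; simp only [Finset.mem_range]; omega
  · intro s _ hs
    simp only [Finset.mem_range, not_lt] at hs
    simp [Nat.choose_eq_zero_of_lt (show a < s by omega)]

/-- Pascal's rule on both binomials gives four products. After the index shift those containing
`choose a s` run over one term fewer, hence the two cutoffs `M` and `M + 1`. -/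
theorem chooseCorr_succ_succ (c : ℝ) (M a j : ℕ) :
    chooseCorr c (M + 1) (a + 1) (j + 1) = c * chooseCorr c (M + 1) a j +
      chooseCorr c (M + 1) a (j + 1) + c * chooseCorr c M a (j + 1) + chooseCorr c M a (j + 2) := by
  unfold chooseCorr
  rw [Finset.sum_range_succ', Finset.sum_range_succ', Finset.sum_range_succ']
  simp only [Finset.mul_sum, mul_add, zero_add, Nat.choose_zero_right]
  have : ∀ s : ℕ, c ^ (s + 1 + (j + 1)) * (((a + 1).choose (s + 1 + (j + 1)) : ℕ) : ℝ) *
      (((a + 1).choose (s + 1) : ℕ) : ℝ) =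
      c * (c ^ (s + 1 + j) * (a.choose (s + 1 + j) : ℝ) * (a.choose (s + 1) : ℝ)) +
      c ^ (s + 1 + (j + 1)) * (a.choose (s + 1 + (j + 1)) : ℝ) * (a.choose (s + 1) : ℝ) +
      c * (c ^ (s + (j + 1)) * (a.choose (s + (j + 1)) : ℝ) * (a.choose s : ℝ)) +
      c ^ (s + (j + 2)) * (a.choose (s + (j + 2)) : ℝ) * (a.choose s : ℝ) := by
    intro s
    rw [show s + 1 + (j + 1) = (s + j + 1) + 1 by ring, show s + 1 + j = s + j + 1 by ring,
      show s + (j + 1) = s + j + 1 by ring, show s + (j + 2) = s + j + 1 + 1 by ring,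
      Nat.choose_succ_succ a (s + j + 1), Nat.choose_succ_succ a s]
    push_cast
    ring
  simp only [this, Finset.sum_add_distrib, Nat.choose_succ_succ a j]
  push_cast
  ring

theorem chooseCorr_succ_zero (c : ℝ) (M a : ℕ) :
    chooseCorr c (M + 1) (a + 1) 0 = c * chooseCorr c M a 0 +
      chooseCorr c (M + 1) a 0 + 2 * chooseCorr c M a 1 := by
  unfold chooseCorr
  rw [Finset.sum_range_succ', Finset.sum_range_succ']
  simp only [Finset.mul_sum]
  have : ∀ s : ℕ, c ^ (s + 1 + 0) * (((a + 1).choose (s + 1 + 0) : ℕ) : ℝ) *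
      (((a + 1).choose (s + 1) : ℕ) : ℝ) =
      c * (c ^ (s + 0) * (a.choose (s + 0) : ℝ) * (a.choose s : ℝ)) +
      c ^ (s + 1 + 0) * (a.choose (s + 1 + 0) : ℝ) * (a.choose (s + 1) : ℝ) +
      2 * (c ^ (s + 1) * (a.choose (s + 1) : ℝ) * (a.choose s : ℝ)) := by
    intro s
    simp only [add_zero, Nat.choose_succ_succ a s]
    push_cast
    ring
  simp only [this, Finset.sum_add_distrib]
  simp
  ring

/-- Moments of the three-term recurrence with constant coefficients `1 + c` and `c`, started at a
point mass: the solution by reflection. -/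
theorem eq_chooseCorr_of_recurrence {c : ℝ} (hc : c ≠ 0) (h : ℕ → ℕ → ℝ)
    (h00 : h 0 0 = 1) (h0 : ∀ j, h 0 (j + 1) = 0)
    (hs0 : ∀ a, h (a + 1) 0 = h a 1 + (1 + c) * h a 0)
    (hs : ∀ a j, h (a + 1) (j + 1) = h a (j + 2) + (1 + c) * h a (j + 1) + c * h a j) (a j : ℕ) :
    h a j = chooseCorr c (a + 1) a j - c⁻¹ * chooseCorr c (a + 1) a (j + 2) := by
  -- The autocorrelation solves the recurrence on all integer heights, and its value at `-j` is `c ^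
  -- (-j)` times that at `j`. Subtracting the copy shifted by two therefore gives zero at height
  -- `-1`, which is the boundary condition.
  have key : ∀ a j : ℕ, chooseCorr c (a + 1 + 1) (a + 1) (j + 1) = c * chooseCorr c (a + 1) a j +
      (1 + c) * chooseCorr c (a + 1) a (j + 1) + chooseCorr c (a + 1) a (j + 2) := by
    intro a j
    rw [chooseCorr_succ_succ, chooseCorr_eq_of_lt c j (show a < a + 1 + 1 by omega),
      chooseCorr_eq_of_lt c (j + 1) (show a < a + 1 + 1 by omega)]
    ring
  -- This is `key` at `j = -1`: by the symmetry, `c` times the value at `-1` is the value at `1`.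
  have key0 : ∀ a : ℕ, chooseCorr c (a + 1 + 1) (a + 1) 0 =
      (1 + c) * chooseCorr c (a + 1) a 0 + 2 * chooseCorr c (a + 1) a 1 := by
    intro a
    rw [chooseCorr_succ_zero, chooseCorr_eq_of_lt c 0 (show a < a + 1 + 1 by omega)]
    ring
  induction a generalizing j with
  | zero =>
    cases j with
    | zero => simp [h00, chooseCorr]
    | succ j => simp [h0, chooseCorr]
  | succ a ih =>
    cases j with
    | zero =>
      rw [hs0, ih, ih, key0, key]
      field_simp
      ring
    | succ j =>
      rw [hs, ih, ih, ih, key, key a (j + 2)]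
      field_simp
      ring

/-- The ratios of neighbouring binomials (`h1`, `h2`) eliminate `k`; the remaining identity is
linear in the product of the outer two. -/
theorem choose_sq_sub_eq_narayana (k r : ℕ) :
    ((k.choose (r + 1) : ℝ)) ^ 2 - k.choose r * k.choose (r + 2) =
      BiregularMP.narayana (k + 1) (r + 1) := by
  have h1 : ((k.choose (r + 1) : ℝ)) * (r + 1) = k.choose r * ((k : ℝ) - r) := by
    rcases le_or_gt r k with h | h
    · have := Nat.choose_succ_right_eq k r
      rw [← Nat.cast_sub h]
      exact_mod_cast this
    · simp [Nat.choose_eq_zero_of_lt h, Nat.choose_eq_zero_of_lt (show k < r + 1 by omega)]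
  have h2 : ((k.choose (r + 2) : ℝ)) * (r + 2) = k.choose (r + 1) * ((k : ℝ) - r - 1) := by
    rcases le_or_gt (r + 1) k with h | h
    · have := Nat.choose_succ_right_eq k (r + 1)
      have h' : ((k - (r + 1) : ℕ) : ℝ) = (k : ℝ) - r - 1 := by
        rw [Nat.cast_sub h]; push_cast; ring
      rw [← h']
      exact_mod_cast this
    · simp [Nat.choose_eq_zero_of_lt h, Nat.choose_eq_zero_of_lt (show k < r + 2 by omega)]
  have h3 : (((k + 1).choose (r + 1) : ℕ) : ℝ) = k.choose r + k.choose (r + 1) := by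
    rw [Nat.choose_succ_succ]; push_cast; ring
  unfold BiregularMP.narayana
  rw [h3, Nat.add_sub_cancel]
  push_cast
  have hr : (r : ℝ) + 1 + 1 ≠ 0 := by positivity
  field_simp
  have e : (k.choose r : ℝ) * (k.choose (r + 2) : ℝ) * (r + 2) =
    (k.choose (r + 1) : ℝ) * ((k.choose (r + 1) : ℝ) * (r + 1) - k.choose r) := by
    rw [mul_assoc, h2, h1]; ring
  linarith

theorem chooseCorr_sub_eq_sum_narayana {c : ℝ} (hc : c ≠ 0) (k : ℕ) :
    chooseCorr c (k + 1) k 0 - c⁻¹ * chooseCorr c (k + 1) k 2 =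
      ∑ r ∈ Finset.range (k + 1), c ^ r * BiregularMP.narayana (k + 1) r := by
  rw [Finset.sum_range_succ']
  have e1 : chooseCorr c (k + 1) k 0 =
      ∑ r ∈ Finset.range k, c ^ (r + 1) * (k.choose (r + 1) : ℝ) ^ 2 + 1 := by
    rw [chooseCorr, Finset.sum_range_succ']
    simp [pow_two, mul_assoc]
  have e2 : c⁻¹ * chooseCorr c (k + 1) k 2 =
      ∑ r ∈ Finset.range k, c ^ (r + 1) * (k.choose r * k.choose (r + 2) : ℝ) := by
    rw [chooseCorr, Finset.sum_range_succ]
    simp only [Nat.choose_eq_zero_of_lt (show k < k + 2 by omega)]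
    simp only [Nat.cast_zero, mul_zero, zero_mul, add_zero, Finset.mul_sum]
    refine Finset.sum_congr rfl fun r _ => ?_
    rw [show r + 2 = r + 1 + 1 by ring, pow_succ]
    field_simp
  rw [e1, e2, add_sub_right_comm, ← Finset.sum_sub_distrib]
  congr 1
  · refine Finset.sum_congr rfl fun r _ => ?_
    rw [← choose_sq_sub_eq_narayana]; ring
  · simp [BiregularMP.narayana]

theorem sum_narayana_of_recurrence {c : ℝ} (hc : c ≠ 0) (h : ℕ → ℕ → ℝ)
    (h00 : h 0 0 = 1) (h0 : ∀ j, h 0 (j + 1) = 0)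
    (hs0 : ∀ a, h (a + 1) 0 = h a 1 + (1 + c) * h a 0)
    (hs : ∀ a j, h (a + 1) (j + 1) = h a (j + 2) + (1 + c) * h a (j + 1) + c * h a j) (k : ℕ) :
    h k 0 = ∑ r ∈ Finset.range (k + 1), c ^ r * BiregularMP.narayana (k + 1) r := by
  rw [eq_chooseCorr_of_recurrence hc h h00 h0 hs0 hs, chooseCorr_sub_eq_sum_narayana hc]

/-- Weighted Dyck-type path counts with alternating weights `1`, `c`. -/
theorem sum_narayana_of_alternating_recurrence {c : ℝ} (hc : c ≠ 0) (g : ℕ → ℕ → ℝ)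
    (g00 : g 0 0 = 1) (g0 : ∀ j, g 0 (j + 1) = 0)
    (gz : ∀ a, g (a + 1) 0 = g a 1)
    (godd : ∀ a i, g (a + 1) (2 * i + 1) = g a (2 * i + 2) + g a (2 * i))
    (geven : ∀ a i, g (a + 1) (2 * i + 2) = g a (2 * i + 3) + c * g a (2 * i + 1)) (k : ℕ) :
    g (2 * (k + 1)) 0 = ∑ r ∈ Finset.range (k + 1), c ^ r * BiregularMP.narayana (k + 1) r := by
  -- Observed at odd times and odd heights, two alternating steps make one step of the constant
  -- recurrence: a return to the same height costs `1 + c`, a descent costs `c`.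
  have := sum_narayana_of_recurrence hc (fun k i => g (2 * k + 1) (2 * i + 1))
    (by simpa [g0, g00] using godd 0 0)
    (fun j => by
      have := godd 0 (j + 1)
      rw [g0, show 2 * (j + 1) = 2 * j + 1 + 1 by ring, g0] at this
      simpa [show 2 * (j + 1) = 2 * j + 1 + 1 by ring] using this)
    (fun a => by
      have e1 := godd (2 * a + 2) 0
      have e2 := geven (2 * a + 1) 0
      have e3 := gz (2 * a + 1)
      simp only [mul_zero, zero_add] at e1 e2 e3
      simp only [mul_zero, zero_add, show 2 * (a + 1) + 1 = 2 * a + 2 + 1 by ring, mul_one,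
        show 2 + 1 = 3 from rfl]
      rw [e1, show 2 * a + 2 = 2 * a + 1 + 1 by ring, e2, e3]
      ring)
    (fun a j => by
      have e1 := godd (2 * a + 2) (j + 1)
      have e2 := geven (2 * a + 1) (j + 1)
      have e3 := geven (2 * a + 1) j
      show g (2 * (a + 1) + 1) (2 * (j + 1) + 1) = _
      rw [show 2 * (a + 1) + 1 = 2 * a + 2 + 1 by ring, e1,
        show 2 * a + 2 = 2 * a + 1 + 1 by ring, e2, show 2 * (j + 1) = 2 * j + 2 by ring, e3,
        show 2 * (j + 2) + 1 = 2 * j + 2 + 3 by ring, show 2 * j + 2 + 1 = 2 * j + 3 by ring]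
      ring) k
  rw [← this, show 2 * (k + 1) = 2 * k + 1 + 1 by ring, gz]

/-! ### Moments of the Marčenko–Pastur law. -/

theorem integral_cos_nat_succ_mul (n : ℕ) :
    ∫ x in (0 : ℝ)..Real.pi, Real.cos (((n : ℝ) + 1) * x) = 0 := by
  rw [intervalIntegral.integral_comp_mul_left (fun x => Real.cos x) (by positivity), integral_cos]
  have := Real.sin_nat_mul_pi (n + 1)
  push_cast at this
  simp [this]

/-- The integral of `(1 + s² + 2 s cos θ) ^ a s ^ j sin ((j + 1) θ) sin θ` over `[0, π]`,
normalised by `2 / π`. -/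
noncomputable def chebyshevMoment (s : ℝ) (a j : ℕ) : ℝ :=
  2 / Real.pi * ∫ x in (0 : ℝ)..Real.pi,
    (1 + s ^ 2 + 2 * s * Real.cos x) ^ a * (s ^ j * (Real.sin (((j : ℝ) + 1) * x) * Real.sin x))

theorem chebyshevMoment_succ_zero (s : ℝ) (a : ℕ) :
    chebyshevMoment s (a + 1) 0 =
      chebyshevMoment s a 1 + (1 + s ^ 2) * chebyshevMoment s a 0 := by
  unfold chebyshevMoment
  rw [← mul_assoc (1 + s ^ 2), mul_comm (1 + s ^ 2), mul_assoc, ← mul_add,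
    ← intervalIntegral.integral_const_mul (1 + s ^ 2), ← intervalIntegral.integral_add
    (Continuous.intervalIntegrable (by fun_prop) _ _)
    (Continuous.intervalIntegrable (by fun_prop) _ _)]
  congr 1
  refine intervalIntegral.integral_congr fun x _ => ?_
  have h2 : Real.sin ((1 + 1) * x) = 2 * Real.sin x * Real.cos x := by
    rw [← Real.sin_two_mul]; norm_num
  simp only [Nat.cast_zero, Nat.cast_one, zero_add, one_mul, h2]
  ring

/-- Multiplication by `2 cos x` sends a sine to the sum of its two neighbours in frequency, and the
weight `s ^ j` makes the coefficients `1` and `s²`. This is the recurrence of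
`sum_narayana_of_recurrence` with `c = s²`. -/
theorem chebyshevMoment_succ_succ (s : ℝ) (a j : ℕ) :
    chebyshevMoment s (a + 1) (j + 1) = chebyshevMoment s a (j + 2) +
      (1 + s ^ 2) * chebyshevMoment s a (j + 1) + s ^ 2 * chebyshevMoment s a j := by
  unfold chebyshevMoment
  rw [← mul_assoc (1 + s ^ 2), mul_comm (1 + s ^ 2), ← mul_assoc (s ^ 2), mul_comm (s ^ 2),
    mul_assoc, mul_assoc, ← mul_add, ← mul_add,
    ← intervalIntegral.integral_const_mul (1 + s ^ 2),
    ← intervalIntegral.integral_const_mul (s ^ 2),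
    ← intervalIntegral.integral_add
    (Continuous.intervalIntegrable (by fun_prop) _ _)
    (Continuous.intervalIntegrable (by fun_prop) _ _),
    ← intervalIntegral.integral_add
    (Continuous.intervalIntegrable (by fun_prop) _ _)
    (Continuous.intervalIntegrable (by fun_prop) _ _)]
  congr 1
  refine intervalIntegral.integral_congr fun x _ => ?_
  have h : Real.sin (((j + 2 : ℕ) + 1 : ℝ) * x) + Real.sin (((j : ℝ) + 1) * x) =
      2 * Real.cos x * Real.sin (((j + 1 : ℕ) + 1 : ℝ) * x) := by
    have e1 : ((j + 2 : ℕ) + 1 : ℝ) * x = ((j + 1 : ℕ) + 1 : ℝ) * x + x := by push_cast; ring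
    have e2 : ((j : ℝ) + 1) * x = ((j + 1 : ℕ) + 1 : ℝ) * x - x := by push_cast; ring
    rw [e1, e2, Real.sin_add, Real.sin_sub]
    ring
  have h' := eq_sub_of_add_eq h
  simp only [h']
  ring

theorem chebyshevMoment_zero_zero (s : ℝ) : chebyshevMoment s 0 0 = 1 := by
  unfold chebyshevMoment
  simp only [pow_zero, one_mul, Nat.cast_zero, zero_add, ← pow_two]
  rw [integral_sin_sq]
  simp

theorem chebyshevMoment_zero_succ (s : ℝ) (j : ℕ) : chebyshevMoment s 0 (j + 1) = 0 := by
  have h : ∀ x : ℝ, Real.sin (((j + 1 : ℕ) + 1 : ℝ) * x) * Real.sin x =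
      2⁻¹ * (Real.cos (((j : ℝ) + 1) * x) - Real.cos (((j + 2 : ℕ) + 1 : ℝ) * x)) := by
    intro x
    have e1 : ((j + 2 : ℕ) + 1 : ℝ) * x = ((j + 1 : ℕ) + 1 : ℝ) * x + x := by push_cast; ring
    have e2 : ((j : ℝ) + 1) * x = ((j + 1 : ℕ) + 1 : ℝ) * x - x := by push_cast; ring
    rw [e1, e2, Real.cos_add, Real.cos_sub]
    ring
  unfold chebyshevMoment
  simp only [pow_zero, one_mul, h]
  rw [intervalIntegral.integral_const_mul, intervalIntegral.integral_const_mul,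
    intervalIntegral.integral_sub (Continuous.intervalIntegrable (by fun_prop) _ _)
    (Continuous.intervalIntegrable (by fun_prop) _ _), integral_cos_nat_succ_mul,
    integral_cos_nat_succ_mul]
  simp

/-- Under `x = 1 + s² + 2 s cos θ` the square root becomes `2 s sin θ`. The substitution decreases
from `θ = 0` to `π`, so its limits are taken in reverse. -/
theorem integral_marcenkoPastur_density {s : ℝ} (hs : 0 < s) (k : ℕ) :
    ∫ x in ((1 - s) ^ 2)..((1 + s) ^ 2),
      x ^ k * Real.sqrt (((1 + s) ^ 2 - x) * (x - (1 - s) ^ 2)) =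
      2 * Real.pi * s ^ 2 * chebyshevMoment s k 0 := by
  have hsub := intervalIntegral.integral_comp_mul_deriv (a := Real.pi) (b := 0)
    (f := fun x => 1 + s ^ 2 + 2 * s * Real.cos x) (f' := fun x => - (2 * s * Real.sin x))
    (g := fun x => x ^ k * Real.sqrt (((1 + s) ^ 2 - x) * (x - (1 - s) ^ 2)))
    (fun x _ => by simpa using ((Real.hasDerivAt_cos x).const_mul (2 * s)).const_add (1 + s ^ 2))
    (Continuous.continuousOn (by fun_prop)) (by fun_prop)
  simp only [Real.cos_pi, Real.cos_zero] at hsub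
  rw [show (1 - s) ^ 2 = 1 + s ^ 2 + 2 * s * -1 by ring,
    show (1 + s) ^ 2 = 1 + s ^ 2 + 2 * s * 1 by ring]
  rw [show (1 - s) ^ 2 = 1 + s ^ 2 + 2 * s * -1 by ring,
    show (1 + s) ^ 2 = 1 + s ^ 2 + 2 * s * 1 by ring] at hsub
  rw [← hsub, intervalIntegral.integral_symm, ← intervalIntegral.integral_neg]
  unfold chebyshevMoment
  rw [← mul_assoc, ← intervalIntegral.integral_const_mul]
  refine intervalIntegral.integral_congr fun x hx => ?_
  rw [Set.uIcc_of_le Real.pi_pos.le] at hx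
  have hsin := Real.sin_nonneg_of_mem_Icc hx
  have e : (1 + s ^ 2 + 2 * s * 1 - (1 + s ^ 2 + 2 * s * Real.cos x)) *
      (1 + s ^ 2 + 2 * s * Real.cos x - (1 + s ^ 2 + 2 * s * -1)) =
      (2 * s * Real.sin x) ^ 2 := by
    have := Real.sin_sq_add_cos_sq x
    linear_combination (- 4 * s ^ 2) * this
  simp only [Function.comp, e, Real.sqrt_sq (show 0 ≤ 2 * s * Real.sin x by positivity)]
  simp only [Nat.cast_zero, zero_add, one_mul, pow_zero]
  field_simp

theorem mpMoment_eq_sum_narayana {c : ℝ} (hc : 0 < c) (hc1 : c ≤ 1) (k : ℕ) :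
    BiregularMP.mpMoment (k + 1) c 1 =
      ∑ r ∈ Finset.range (k + 1), c ^ r * BiregularMP.narayana (k + 1) r := by
  obtain ⟨s, hs, rfl⟩ : ∃ s : ℝ, 0 < s ∧ c = s ^ 2 :=
    ⟨Real.sqrt c, Real.sqrt_pos.2 hc, (Real.sq_sqrt hc.le).symm⟩
  rw [← sum_narayana_of_recurrence hc.ne' (chebyshevMoment s) (chebyshevMoment_zero_zero s)
    (chebyshevMoment_zero_succ s) (chebyshevMoment_succ_zero s) (chebyshevMoment_succ_succ s)]
  have hle : (1 - s) ^ 2 ≤ (1 + s) ^ 2 := by nlinarith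
  -- The atom's weight is nonpositive for ratio at most `1`, and `ENNReal.ofReal` truncates it to
  -- zero.
  have hatom : ENNReal.ofReal (1 - 1 / s ^ 2) = 0 := by
    rw [ENNReal.ofReal_eq_zero, sub_nonpos, le_div_iff₀ hc]
    linarith
  unfold BiregularMP.mpMoment BiregularMP.marcenkoPastur
  rw [hatom, zero_smul, zero_add, Real.sqrt_sq hs.le]
  simp only [one_mul, mul_one]
  rw [integral_withDensity_eq_integral_toReal_smul (by fun_prop) (by simp),
    MeasureTheory.integral_Icc_eq_integral_Ioc, ← intervalIntegral.integral_of_le hle]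
  have hI : ∫ x in ((1 - s) ^ 2)..((1 + s) ^ 2),
      (ENNReal.ofReal (Real.sqrt (((1 + s) ^ 2 - x) * (x - (1 - s) ^ 2)) /
        (2 * Real.pi * x * s ^ 2))).toReal • x ^ (k + 1) =
      ∫ x in ((1 - s) ^ 2)..((1 + s) ^ 2), (2 * Real.pi * s ^ 2)⁻¹ *
        (x ^ k * Real.sqrt (((1 + s) ^ 2 - x) * (x - (1 - s) ^ 2))) := by
    refine intervalIntegral.integral_congr_ae (MeasureTheory.ae_of_all _ fun x hx => ?_)
    -- The left endpoint, which is `0` when `s = 1`, is excluded, so the `x` in the density cancels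
    -- one power of `x ^ (k + 1)`.
    rw [Set.uIoc_of_le hle] at hx
    have hx0 : 0 < x := lt_of_le_of_lt (sq_nonneg _) hx.1
    rw [ENNReal.toReal_ofReal (by positivity), smul_eq_mul]
    field_simp
    ring
  rw [hI, intervalIntegral.integral_const_mul, integral_marcenkoPastur_density hs]
  field_simp

/-! ### Edge switchings in biregular graphs. -/

section Switching

variable {α β : Type*} [Fintype α] [Fintype β] [DecidableEq α] [DecidableEq β]

/-- The edge sets of bipartite graphs in which the left vertices have degree `l` and the right
vertices have degree `d`. -/
def biregularSets (α β : Type*) [Fintype α] [Fintype β] [DecidableEq α] [DecidableEq β]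
    (l d : ℕ) : Finset (Finset (α × β)) :=
  {H | (∀ u, (H.filter fun e => e.1 = u).card = l) ∧ ∀ v, (H.filter fun e => e.2 = v).card = d}

theorem mem_biregularSets {l d : ℕ} {H : Finset (α × β)} :
    H ∈ biregularSets α β l d ↔
      (∀ u, (H.filter fun e => e.1 = u).card = l) ∧
        ∀ v, (H.filter fun e => e.2 = v).card = d := by
  simp [biregularSets]

theorem card_of_mem_biregularSets {l d : ℕ} {H : Finset (α × β)}
    (hH : H ∈ biregularSets α β l d) : H.card = Fintype.card β * d := by
  rw [Finset.card_eq_sum_card_fiberwise (f := Prod.snd) (t := Finset.univ) (by simp),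
    Finset.sum_congr rfl fun v _ => (mem_biregularSets.1 hH).2 v]
  simp

/-- Replace the edges `e`, `e'` by the two other edges on the same end vertices. -/
def switchEdges (H : Finset (α × β)) (e e' : α × β) : Finset (α × β) :=
  insert (e.1, e'.2) (insert (e'.1, e.2) ((H.erase e).erase e'))

-- The weight is arbitrary so that indicators of a left or right vertex give both degree conditions
-- at once.
omit [Fintype α] [Fintype β] in
theorem sum_switchEdges {H : Finset (α × β)} {e e' : α × β} (he : e ∈ H) (he' : e' ∈ H)
    (h1 : (e.1, e'.2) ∉ H) (h2 : (e'.1, e.2) ∉ H) (w : α × β → ℤ) :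
    ∑ p ∈ switchEdges H e e', w p =
      ∑ p ∈ H, w p - w e - w e' + w (e'.1, e.2) + w (e.1, e'.2) := by
  obtain ⟨u, v⟩ := e
  obtain ⟨u', v'⟩ := e'
  have hne : u ≠ u' := by rintro rfl; exact h1 he'
  unfold switchEdges
  rw [Finset.sum_insert, Finset.sum_insert, Finset.sum_erase_eq_sub, Finset.sum_erase_eq_sub he]
  · ring
  · simp [he', hne.symm]
  · simp [h2]
  · simp [h1, hne]

theorem switchEdges_mem_biregularSets {l d : ℕ} {H : Finset (α × β)} {e e' : α × β}
    (hH : H ∈ biregularSets α β l d) (he : e ∈ H) (he' : e' ∈ H)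
    (h1 : (e.1, e'.2) ∉ H) (h2 : (e'.1, e.2) ∉ H) :
    switchEdges H e e' ∈ biregularSets α β l d := by
  rw [mem_biregularSets] at hH ⊢
  constructor
  · intro u
    rw [← hH.1 u]
    zify
    rw [Finset.natCast_card_filter, Finset.natCast_card_filter, sum_switchEdges he he' h1 h2]
    ring
  · intro v
    rw [← hH.2 v]
    zify
    rw [Finset.natCast_card_filter, Finset.natCast_card_filter, sum_switchEdges he he' h1 h2]
    ring

-- A switching is undone by switching the two new edges, so for fixed `e` the switched graph and
-- `e'` determine `H`. This is the injectivity in the double count.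
omit [Fintype α] [Fintype β] in
theorem switchEdges_switchEdges {H : Finset (α × β)} {e e' : α × β} (he : e ∈ H) (he' : e' ∈ H)
    (h1 : (e.1, e'.2) ∉ H) (h2 : (e'.1, e.2) ∉ H) :
    switchEdges (switchEdges H e e') (e.1, e'.2) (e'.1, e.2) = H := by
  obtain ⟨u, v⟩ := e
  obtain ⟨u', v'⟩ := e'
  have hne : u ≠ u' := by rintro rfl; exact h1 he'
  have hne' : v ≠ v' := by rintro rfl; exact h1 he
  ext ⟨a, b⟩
  simp only [switchEdges, Finset.mem_insert, Finset.mem_erase, Prod.mk.injEq, ne_eq] at *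
  grind

/-- The switching estimate: the edge `e` is in few of the biregular graphs that contain `F`. -/
theorem card_biregularSets_insert_mul_le (l d : ℕ) (F : Finset (α × β)) (e : α × β) (he : e ∉ F) :
    ((biregularSets α β l d).filter fun H => insert e F ⊆ H).card *
        (Fintype.card β * d - (2 * (l * d) + F.card)) ≤
      ((biregularSets α β l d).filter fun H => F ⊆ H).card * (l * d) := by
  classical
  set S := (biregularSets α β l d).filter fun H => insert e F ⊆ H with hS
  set T := (biregularSets α β l d).filter fun H => F ⊆ H with hT
  -- The edges against which `e` can be switched without touching `F`. Each of the two adjacency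
  -- conditions excludes at most `l * d` edges.
  let good : Finset (α × β) → Finset (α × β) := fun H =>
    H.filter fun e' => e' ∉ F ∧ (e.1, e'.2) ∉ H ∧ (e'.1, e.2) ∉ H
  -- The pairs that can have been `e'`, seen from the switched graph: both new edges must be present
  -- in it.
  let back : Finset (α × β) → Finset (α × β) := fun H =>
    (H.filter fun q => q.2 = e.2).image Prod.fst ×ˢ (H.filter fun q => q.1 = e.1).image Prod.snd
  have hgood : ∀ H ∈ S, Fintype.card β * d - (2 * (l * d) + F.card) ≤ (good H).card := by
    intro H hH
    rw [hS, Finset.mem_filter] at hH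
    have hc := card_of_mem_biregularSets hH.1
    have hb := mem_biregularSets.1 hH.1
    have hsub : H ⊆ good H ∪ (F ∪
        (((H.filter fun q => q.1 = e.1).biUnion fun q => H.filter fun q' => q'.2 = q.2) ∪
        ((H.filter fun q => q.2 = e.2).biUnion fun q => H.filter fun q' => q'.1 = q.1))) := by
      intro q hq
      simp only [good, Finset.mem_union, Finset.mem_filter, Finset.mem_biUnion]
      by_cases h1 : q ∈ F
      · simp [h1]
      by_cases h2 : (e.1, q.2) ∈ H
      · exact Or.inr (Or.inr (Or.inl ⟨_, ⟨h2, rfl⟩, hq, rfl⟩))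
      by_cases h3 : (q.1, e.2) ∈ H
      · exact Or.inr (Or.inr (Or.inr ⟨_, ⟨h3, rfl⟩, hq, rfl⟩))
      exact Or.inl ⟨hq, h1, h2, h3⟩
    have h1 := Finset.card_le_card hsub
    have h2 : ((H.filter fun q => q.1 = e.1).biUnion
        fun q => H.filter fun q' => q'.2 = q.2).card ≤ l * d := by
      rw [← hb.1 e.1]
      exact Finset.card_biUnion_le_card_mul _ _ _ fun q _ => (hb.2 q.2).le
    have h3 : ((H.filter fun q => q.2 = e.2).biUnion
        fun q => H.filter fun q' => q'.1 = q.1).card ≤ d * l := by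
      rw [← hb.2 e.2]
      exact Finset.card_biUnion_le_card_mul _ _ _ fun q _ => (hb.1 q.1).le
    rw [mul_comm d l] at h3
    have h4 := Finset.card_union_le (good H) (F ∪
        (((H.filter fun q => q.1 = e.1).biUnion fun q => H.filter fun q' => q'.2 = q.2) ∪
        ((H.filter fun q => q.2 = e.2).biUnion fun q => H.filter fun q' => q'.1 = q.1)))
    have h5 := Finset.card_union_le F
        (((H.filter fun q => q.1 = e.1).biUnion fun q => H.filter fun q' => q'.2 = q.2) ∪
        ((H.filter fun q => q.2 = e.2).biUnion fun q => H.filter fun q' => q'.1 = q.1))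
    have h6 := Finset.card_union_le
        ((H.filter fun q => q.1 = e.1).biUnion fun q => H.filter fun q' => q'.2 = q.2)
        ((H.filter fun q => q.2 = e.2).biUnion fun q => H.filter fun q' => q'.1 = q.1)
    omega
  have hback : ∀ H ∈ T, (back H).card ≤ l * d := by
    intro H hH
    rw [hT, Finset.mem_filter] at hH
    have hb := mem_biregularSets.1 hH.1
    simp only [back]
    rw [Finset.card_product, mul_comm l d]
    exact Nat.mul_le_mul (Finset.card_image_le.trans (hb.2 _).le)
      (Finset.card_image_le.trans (hb.1 _).le)
  calc S.card * (Fintype.card β * d - (2 * (l * d) + F.card))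
      ≤ ∑ H ∈ S, (good H).card := by
        rw [← smul_eq_mul]
        exact Finset.card_nsmul_le_sum _ _ _ hgood
    _ = (S.sigma good).card := (Finset.card_sigma _ _).symm
    _ ≤ (T.sigma back).card := by
        refine Finset.card_le_card_of_injOn (fun x => ⟨switchEdges x.1 e x.2, x.2⟩) ?_ ?_
        · rintro ⟨H, q⟩ hx
          simp only [Finset.coe_sigma, Set.mem_sigma_iff, Finset.mem_coe, hS, hT, good, back,
            Finset.mem_filter, Finset.insert_subset_iff, Finset.mem_product, Finset.mem_image]
            at hx ⊢
          obtain ⟨⟨hH, he, hF⟩, hq, hqF, h1, h2⟩ := hx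
          refine ⟨⟨switchEdges_mem_biregularSets hH he hq h1 h2, fun f hf => ?_⟩,
            ⟨(q.1, e.2), ?_⟩, ⟨(e.1, q.2), ?_⟩⟩
          · have : f ≠ e := by rintro rfl; contradiction
            have : f ≠ q := by rintro rfl; contradiction
            have := hF hf
            simp [switchEdges, *]
          · simp [switchEdges]
          · simp [switchEdges]
        · rintro ⟨H, q⟩ hx ⟨H', q'⟩ hx' heq
          simp only [Finset.coe_sigma, Set.mem_sigma_iff, Finset.mem_coe, hS, good,
            Finset.mem_filter, Finset.insert_subset_iff] at hx hx'
          obtain ⟨⟨hH, he, hF⟩, hq, hqF, h1, h2⟩ := hx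
          obtain ⟨⟨hH', he', hF'⟩, hq', hqF', h1', h2'⟩ := hx'
          simp only [Sigma.mk.injEq, heq_eq_eq] at heq
          obtain ⟨heq, rfl⟩ := heq
          have := switchEdges_switchEdges he hq h1 h2
          rw [heq, switchEdges_switchEdges he' hq' h1' h2'] at this
          simp [this]
    _ = ∑ H ∈ T, (back H).card := Finset.card_sigma _ _
    _ ≤ T.card * (l * d) := by
        rw [← smul_eq_mul]
        exact Finset.sum_le_card_nsmul _ _ _ hback

/-- Each edge of `F` costs one switching estimate, that is one factor `p`; `K` bounds the size of
`F` so that the same `p` serves throughout. -/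
theorem card_biregularSets_superset_le (l d K : ℕ) (p : ℝ)
    (hp : (l * d : ℝ) ≤ p * ((Fintype.card β * d : ℝ) - (2 * (l * d) + K))) (hp0 : 0 ≤ p)
    (hK : 2 * (l * d) + K < Fintype.card β * d)
    (F : Finset (α × β)) (hF : F.card ≤ K) :
    (((biregularSets α β l d).filter fun H => F ⊆ H).card : ℝ) ≤
      p ^ F.card * (biregularSets α β l d).card := by
  induction F using Finset.induction_on with
  | empty => simp
  | insert e F he ih =>
    rw [Finset.card_insert_of_notMem he] at hF ⊢
    have h := card_biregularSets_insert_mul_le l d F e he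
    have ih := ih (by omega)
    set a := ((biregularSets α β l d).filter fun H => insert e F ⊆ H).card
    set b := ((biregularSets α β l d).filter fun H => F ⊆ H).card
    set M := Fintype.card β * d - (2 * (l * d) + F.card) with hM
    have hMpos : (0 : ℝ) < M := by
      have : 0 < M := by omega
      exact_mod_cast this
    have hM' : (Fintype.card β * d : ℝ) - (2 * (l * d) + K) ≤ M := by
      have : Fintype.card β * d ≤ M + (2 * (l * d) + K) := by omega
      have : (Fintype.card β * d : ℝ) ≤ M + (2 * (l * d) + K) := by exact_mod_cast this
      linarith
    have h' : (a : ℝ) * M ≤ b * (l * d) := by exact_mod_cast h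
    have : (a : ℝ) * M ≤ (p * b) * M := by
      calc (a : ℝ) * M ≤ b * (l * d) := h'
        _ ≤ b * (p * M) := by
          exact mul_le_mul_of_nonneg_left
            (hp.trans (mul_le_mul_of_nonneg_left hM' hp0)) (Nat.cast_nonneg _)
        _ = _ := by ring
    have := le_of_mul_le_mul_right this hMpos
    calc (a : ℝ) ≤ p * b := this
      _ ≤ p * (p ^ F.card * (biregularSets α β l d).card) := by gcongr
      _ = _ := by ring

end Switching

/-! ### Non-backtracking walks and their three-term recurrence. -/

section NonBacktracking

open Classical in
/-- The number of non-backtracking walks of length `j + 1` from `v` whose last step goes from `a`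
to `b`. -/
noncomputable def nbDart {V : Type*} [Fintype V] (G : SimpleGraph V) : ℕ → V → V → V → ℕ
  | 0, v, a, b => if a = v ∧ G.Adj a b then 1 else 0
  | j + 1, v, b, c => if G.Adj b c then ∑ a, if a = c then 0 else nbDart G j v a b else 0

open Classical in
/-- The matrix that counts non-backtracking walks of length `j` by their end vertices. -/
noncomputable def nbMatrix {V : Type*} [Fintype V] (G : SimpleGraph V) : ℕ → Matrix V V ℝ
  | 0 => 1
  | j + 1 => Matrix.of fun v c => ∑ b, (nbDart G j v b c : ℝ)

variable {V : Type*} [Fintype V] {G : SimpleGraph V}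

theorem adj_of_nbDart_ne_zero {j : ℕ} {v a b : V} (h : nbDart G j v a b ≠ 0) : G.Adj a b := by
  by_contra hab
  cases j <;> simp [nbDart, hab] at h

-- Walks that end at `b` extend to `c`, except those that have just come from `c`.
open Classical in
theorem nbDart_succ_cast (j : ℕ) (v b c : V) :
    (nbDart G (j + 1) v b c : ℝ) =
      G.adjMatrix ℝ b c * (nbMatrix G (j + 1) v b - nbDart G j v c b) := by
  by_cases h : G.Adj b c
  · simp only [nbDart, h, if_true, SimpleGraph.adjMatrix_apply, one_mul, nbMatrix, Matrix.of_apply]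
    push_cast
    rw [eq_sub_iff_add_eq, ← Finset.sum_erase_add _ _ (Finset.mem_univ c),
      ← Finset.sum_erase_add Finset.univ _ (Finset.mem_univ c)]
    simp only [if_true, add_zero]
    congr 1
    refine Finset.sum_congr rfl fun a ha => ?_
    simp [(Finset.mem_erase.1 ha).1]
  · simp [nbDart, h]

open Classical in
theorem nbMatrix_one : nbMatrix G 1 = G.adjMatrix ℝ := by
  ext v c
  simp [nbMatrix, nbDart, SimpleGraph.adjMatrix_apply, ite_and]

open Classical in
theorem sum_adjMatrix_row (c : V) : ∑ b, G.adjMatrix ℝ c b = G.degree c := by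
  simp [SimpleGraph.adjMatrix_apply, Finset.sum_boole, ← SimpleGraph.card_neighborFinset_eq_degree,
    SimpleGraph.neighborFinset_eq_filter]

open Classical in
theorem sum_adjMatrix_mul_nbDart_zero (v c : V) :
    ∑ b, G.adjMatrix ℝ b c * (nbDart G 0 v c b : ℝ) = G.degree c * nbMatrix G 0 v c := by
  have h : ∀ b, G.adjMatrix ℝ b c * (nbDart G 0 v c b : ℝ) =
      G.adjMatrix ℝ c b * nbMatrix G 0 v c := by
    intro b
    by_cases hb : G.Adj c b
    · simp [nbDart, nbMatrix, hb, hb.symm, Matrix.one_apply, eq_comm]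
    · simp [nbDart, hb]
  simp_rw [h]
  rw [← Finset.sum_mul, sum_adjMatrix_row]

-- A walk that arrived at `c` by an edge may leave by any other, hence `degree - 1`. At length zero
-- no edge is forbidden, and the factor is the full degree.
open Classical in
theorem sum_adjMatrix_mul_nbDart_succ (j : ℕ) (v c : V) :
    ∑ b, G.adjMatrix ℝ b c * (nbDart G (j + 1) v c b : ℝ) =
      (G.degree c - 1) * nbMatrix G (j + 1) v c := by
  have h : ∀ b, G.adjMatrix ℝ b c * (nbDart G (j + 1) v c b : ℝ) =
      G.adjMatrix ℝ c b * nbMatrix G (j + 1) v c - nbDart G j v b c := by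
    intro b
    rw [nbDart_succ_cast]
    by_cases hb : G.Adj c b
    · simp [hb, hb.symm]
    · have : nbDart G j v b c = 0 := by
        by_contra h0
        exact hb (adj_of_nbDart_ne_zero h0).symm
      simp [hb, this]
  simp_rw [h]
  rw [Finset.sum_sub_distrib, ← Finset.sum_mul, sub_mul, one_mul, sum_adjMatrix_row]
  rfl

open Classical in
theorem nbMatrix_mul_adjMatrix_zero :
    nbMatrix G 0 * G.adjMatrix ℝ = nbMatrix G 1 := by
  rw [nbMatrix_one]
  simp [nbMatrix]

open Classical in
theorem nbMatrix_mul_adjMatrix_apply (j : ℕ) (v c : V) :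
    (nbMatrix G (j + 1) * G.adjMatrix ℝ) v c = nbMatrix G (j + 2) v c +
      ∑ b, G.adjMatrix ℝ b c * (nbDart G j v c b : ℝ) := by
  rw [Matrix.mul_apply, show nbMatrix G (j + 2) v c = ∑ b, (nbDart G (j + 1) v b c : ℝ) from rfl,
    ← Finset.sum_add_distrib]
  refine Finset.sum_congr rfl fun b _ => ?_
  rw [nbDart_succ_cast]
  ring

open Classical in
theorem nbMatrix_mul_adjMatrix_one :
    nbMatrix G 1 * G.adjMatrix ℝ = nbMatrix G 2 +
      nbMatrix G 0 * Matrix.diagonal fun c => (G.degree c : ℝ) := by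
  ext v c
  rw [nbMatrix_mul_adjMatrix_apply, sum_adjMatrix_mul_nbDart_zero, Matrix.add_apply,
    Matrix.mul_diagonal, mul_comm]

open Classical in
theorem nbMatrix_mul_adjMatrix_add_two (j : ℕ) :
    nbMatrix G (j + 2) * G.adjMatrix ℝ = nbMatrix G (j + 3) +
      nbMatrix G (j + 1) * Matrix.diagonal fun c => (G.degree c : ℝ) - 1 := by
  ext v c
  rw [nbMatrix_mul_adjMatrix_apply, sum_adjMatrix_mul_nbDart_succ, Matrix.add_apply,
    Matrix.mul_diagonal, mul_comm]

theorem side_of_nbDart_ne_zero {σ : V → ZMod 2} (hσ : ∀ a b, G.Adj a b → σ b = σ a + 1)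
    {j : ℕ} {v a b : V} (h : nbDart G j v a b ≠ 0) : σ b = σ v + (j + 1 : ℕ) := by
  induction j generalizing a b with
  | zero =>
    have h1 := adj_of_nbDart_ne_zero h
    have : a = v := by
      by_contra hav
      simp [nbDart, hav] at h
    rw [hσ a b h1, this]
    simp
  | succ j ih =>
    have h1 := adj_of_nbDart_ne_zero h
    simp only [nbDart, h1, if_true] at h
    obtain ⟨x, -, hx⟩ := Finset.exists_ne_zero_of_sum_ne_zero h
    have hx' : nbDart G j v x a ≠ 0 := by
      intro h0
      simp [h0] at hx
    rw [hσ a b h1, ih hx']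
    push_cast
    ring

theorem side_of_nbMatrix_ne_zero {σ : V → ZMod 2} (hσ : ∀ a b, G.Adj a b → σ b = σ a + 1)
    {j : ℕ} {v b : V} (h : nbMatrix G j v b ≠ 0) : σ b = σ v + (j : ℕ) := by
  cases j with
  | zero =>
    by_contra hb
    have : v ≠ b := by rintro rfl; simp at hb
    simp [nbMatrix, this] at h
  | succ j =>
    obtain ⟨a, -, ha⟩ := Finset.exists_ne_zero_of_sum_ne_zero h
    exact side_of_nbDart_ne_zero (a := a) hσ (by exact_mod_cast ha)

open Classical in
theorem side_of_adjMatrix_pow_ne_zero {σ : V → ZMod 2} (hσ : ∀ a b, G.Adj a b → σ b = σ a + 1)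
    {j : ℕ} {v b : V} (h : (G.adjMatrix ℝ ^ j) v b ≠ 0) : σ b = σ v + (j : ℕ) := by
  induction j generalizing b with
  | zero =>
    by_contra hb
    have : v ≠ b := by rintro rfl; simp at hb
    simp [this] at h
  | succ j ih =>
    rw [pow_succ, Matrix.mul_apply] at h
    obtain ⟨a, -, ha⟩ := Finset.exists_ne_zero_of_sum_ne_zero h
    have h1 : G.Adj a b := by
      by_contra hab
      simp [hab] at ha
    rw [hσ a b h1, ih (left_ne_zero_of_mul ha)]
    push_cast
    ring

open Classical in
/-- The trace over the side `σ = 0` of the `j`-th non-backtracking matrix times the `a`-th power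
of the adjacency matrix. -/
noncomputable def nbTrace (G : SimpleGraph V) (σ : V → ZMod 2) (a j : ℕ) : ℝ :=
  ∑ v with σ v = 0, (nbMatrix G j * G.adjMatrix ℝ ^ a) v v

theorem nbTrace_succ_zero (σ : V → ZMod 2) (a : ℕ) :
    nbTrace G σ (a + 1) 0 = nbTrace G σ a 1 := by
  classical
  unfold nbTrace
  rw [pow_succ', ← mul_assoc, nbMatrix_mul_adjMatrix_zero]

-- Walks of length `j` from the side `σ = 0` end on the side given by the parity of `j`, where the
-- degree is constant; the diagonal matrix thus acts as a scalar.
open Classical in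
theorem sum_nbMatrix_mul_diagonal {σ : V → ZMod 2} (hσ : ∀ a b, G.Adj a b → σ b = σ a + 1)
    (j : ℕ) (f : V → ℝ) (γ : ℝ) (hf : ∀ w, σ w = (j : ℕ) → f w = γ) (M : Matrix V V ℝ) :
    ∑ v with σ v = 0, (nbMatrix G j * Matrix.diagonal f * M) v v =
      γ * ∑ v with σ v = 0, (nbMatrix G j * M) v v := by
  rw [Finset.mul_sum]
  refine Finset.sum_congr rfl fun v hv => ?_
  rw [Matrix.mul_apply, Matrix.mul_apply, Finset.mul_sum]
  refine Finset.sum_congr rfl fun w _ => ?_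
  rw [Matrix.mul_diagonal]
  by_cases h : nbMatrix G j v w = 0
  · simp [h]
  · rw [hf w (by rw [side_of_nbMatrix_ne_zero hσ h, (Finset.mem_filter.1 hv).2, zero_add])]
    ring

open Classical in
theorem nbTrace_succ_one {σ : V → ZMod 2} (hσ : ∀ a b, G.Adj a b → σ b = σ a + 1) {d : ℕ}
    (hd : ∀ w, σ w = 0 → G.degree w = d) (a : ℕ) :
    nbTrace G σ (a + 1) 1 = nbTrace G σ a 2 + d * nbTrace G σ a 0 := by
  unfold nbTrace
  rw [← sum_nbMatrix_mul_diagonal hσ 0 (fun w => (G.degree w : ℝ)) d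
    (fun w hw => by rw [hd w (by simpa using hw)]), ← Finset.sum_add_distrib]
  rw [pow_succ', ← mul_assoc, nbMatrix_mul_adjMatrix_one, add_mul]
  simp only [Matrix.add_apply]

open Classical in
theorem nbTrace_succ_add_two {σ : V → ZMod 2} (hσ : ∀ a b, G.Adj a b → σ b = σ a + 1) {γ : ℝ}
    (j : ℕ) (hγ : ∀ w, σ w = (j + 1 : ℕ) → (G.degree w : ℝ) - 1 = γ) (a : ℕ) :
    nbTrace G σ (a + 1) (j + 2) = nbTrace G σ a (j + 3) + γ * nbTrace G σ a (j + 1) := by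
  unfold nbTrace
  rw [← sum_nbMatrix_mul_diagonal hσ (j + 1) (fun w => (G.degree w : ℝ) - 1) γ hγ,
    ← Finset.sum_add_distrib]
  rw [pow_succ', ← mul_assoc, nbMatrix_mul_adjMatrix_add_two, add_mul]
  simp only [Matrix.add_apply]

open Classical in
theorem trace_adjMatrix_pow_odd {σ : V → ZMod 2} (hσ : ∀ a b, G.Adj a b → σ b = σ a + 1)
    (k : ℕ) : (G.adjMatrix ℝ ^ (2 * k + 1)).trace = 0 := by
  refine Finset.sum_eq_zero fun v _ => ?_
  by_contra h
  have := side_of_adjMatrix_pow_ne_zero hσ h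
  have h2 : (2 : ZMod 2) = 0 := rfl
  simp [h2] at this

-- Both sides contribute equally by cyclicity of the trace, one factor `A` being moved across. This
-- fails for exponent zero, where the traces are the sizes of the classes.
open Classical in
theorem trace_adjMatrix_pow_succ {σ : V → ZMod 2} (hσ : ∀ a b, G.Adj a b → σ b = σ a + 1)
    (k : ℕ) : (G.adjMatrix ℝ ^ (k + 1)).trace = 2 * nbTrace G σ (k + 1) 0 := by
  have hsplit : (G.adjMatrix ℝ ^ (k + 1)).trace =
      ∑ v with σ v = 0, (G.adjMatrix ℝ ^ (k + 1)) v v +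
        ∑ v with σ v = 1, (G.adjMatrix ℝ ^ (k + 1)) v v := by
    rw [Matrix.trace, ← Finset.sum_filter_add_sum_filter_not _ (fun v => σ v = 0)]
    congr 1
    refine Finset.sum_congr ?_ fun _ _ => rfl
    ext v
    have : ∀ z : ZMod 2, ¬ z = 0 ↔ z = 1 := by decide
    simp [this]
  have hswap : ∑ v with σ v = 1, (G.adjMatrix ℝ ^ (k + 1)) v v =
      ∑ v with σ v = 0, (G.adjMatrix ℝ ^ (k + 1)) v v := by
    nth_rewrite 1 [pow_succ']
    rw [pow_succ]
    simp only [Matrix.mul_apply, Finset.sum_filter]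
    have h1 : ∀ v, (if σ v = 1 then ∑ w, G.adjMatrix ℝ v w * (G.adjMatrix ℝ ^ k) w v else 0) =
        ∑ w, if σ v = 1 then G.adjMatrix ℝ v w * (G.adjMatrix ℝ ^ k) w v else 0 := by
      intro v; split_ifs <;> simp
    have h2 : ∀ w, (if σ w = 0 then ∑ v, (G.adjMatrix ℝ ^ k) w v * G.adjMatrix ℝ v w else 0) =
        ∑ v, if σ w = 0 then (G.adjMatrix ℝ ^ k) w v * G.adjMatrix ℝ v w else 0 := by
      intro v; split_ifs <;> simp
    simp_rw [h1, h2]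
    rw [Finset.sum_comm]
    refine Finset.sum_congr rfl fun w _ => Finset.sum_congr rfl fun v _ => ?_
    by_cases h : G.Adj v w
    · have e := hσ v w h
      have : σ v = 1 ↔ σ w = 0 := by
        rw [e]
        generalize σ v = z
        revert z; decide
      simp only [this, mul_comm]
    · simp [h]
  rw [hsplit, hswap, two_mul]
  simp [nbTrace, nbMatrix]

end NonBacktracking

/-! ### Closed non-backtracking walks and removal of tails. -/

section ClosedWalks

variable {V : Type*}

/-- A sequence of vertices that is a non-backtracking walk. -/
def IsNBWalk (G : SimpleGraph V) {n : ℕ} (x : Fin n → V) : Prop :=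
  (∀ (i : ℕ) (h : i + 1 < n), G.Adj (x ⟨i, by omega⟩) (x ⟨i + 1, h⟩)) ∧
    ∀ (i : ℕ) (h : i + 2 < n), x ⟨i, by omega⟩ ≠ x ⟨i + 2, h⟩

theorem isNBWalk_snoc {G : SimpleGraph V} {j : ℕ} {x : Fin (j + 2) → V} (hx : IsNBWalk G x) {c : V}
    (h1 : G.Adj (x ⟨j + 1, by omega⟩) c) (h2 : x ⟨j, by omega⟩ ≠ c) :
    IsNBWalk G (Fin.snoc x c : Fin (j + 3) → V) := by
  constructor
  · intro i hi
    rcases Nat.lt_or_ge (i + 1) (j + 2) with h | h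
    · simpa [Fin.snoc, h, show i < j + 2 by omega] using hx.1 i h
    · obtain rfl : i = j + 1 := by omega
      simpa [Fin.snoc] using h1
  · intro i hi
    rcases Nat.lt_or_ge (i + 2) (j + 2) with h | h
    · simpa [Fin.snoc, show i < j by omega, show i < j + 2 by omega] using hx.2 i h
    · obtain rfl : i = j := by omega
      simpa [Fin.snoc] using h2

variable [Fintype V]

open Classical in
theorem nbDart_le_card (G : SimpleGraph V) (j : ℕ) (v a b : V) :
    nbDart G j v a b ≤ (Finset.univ.filter fun x : Fin (j + 2) → V => IsNBWalk G x ∧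
      x ⟨0, by omega⟩ = v ∧ x ⟨j, by omega⟩ = a ∧ x ⟨j + 1, by omega⟩ = b).card := by
  induction j generalizing a b with
  | zero =>
    simp only [nbDart]
    split_ifs with h
    · rw [Nat.one_le_iff_ne_zero, ← Nat.pos_iff_ne_zero, Finset.card_pos]
      refine ⟨![a, b], ?_⟩
      simp only [Finset.mem_filter, Finset.mem_univ, true_and]
      refine ⟨⟨fun i hi => ?_, fun i hi => by omega⟩, ?_, ?_, ?_⟩
      · obtain rfl : i = 0 := by omega
        simpa using h.2
      · simpa using h.1
      · simp
      · simp
    · exact Nat.zero_le _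
  | succ j ih =>
    simp only [nbDart]
    split_ifs with h
    · calc ∑ x, (if x = b then 0 else nbDart G j v x a)
          ≤ ∑ z with z ≠ b, (Finset.univ.filter fun x : Fin (j + 2) → V => IsNBWalk G x ∧
              x ⟨0, by omega⟩ = v ∧ x ⟨j, by omega⟩ = z ∧ x ⟨j + 1, by omega⟩ = a).card := by
            rw [Finset.sum_filter]
            refine Finset.sum_le_sum fun z _ => ?_
            by_cases hz : z = b
            · simp [hz]
            · simpa [hz] using ih z a
        _ = _ := (Finset.card_sigma _ _).symm
        _ ≤ _ := by
            refine Finset.card_le_card_of_injOn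
              (fun y => (Fin.snoc y.2 b : Fin (j + 3) → V)) ?_ ?_
            · rintro ⟨z, x⟩ hx
              simp only [Finset.coe_sigma, Set.mem_sigma_iff, Finset.mem_coe, Finset.mem_filter,
                Finset.mem_univ, true_and] at hx ⊢
              obtain ⟨hz, hx, h0, h1, h2⟩ := hx
              refine ⟨isNBWalk_snoc hx (by rwa [h2]) (by rwa [h1]), ?_, ?_, ?_⟩
              · simpa [Fin.snoc] using h0
              · simpa [Fin.snoc] using h2
              · simp [Fin.snoc]
            · rintro ⟨z, x⟩ hx ⟨z', x'⟩ hx' heq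
              simp only [Finset.coe_sigma, Set.mem_sigma_iff, Finset.mem_coe, Finset.mem_filter,
                Finset.mem_univ, true_and] at hx hx'
              have := Fin.snoc_injective2 heq
              obtain ⟨rfl, -⟩ := this
              obtain rfl : z = z' := hx.2.2.2.1.symm.trans hx'.2.2.2.1
              rfl
    · exact Nat.zero_le _

open Classical in
/-- Closed non-backtracking walks of length `n`. -/
noncomputable def closedNB (G : SimpleGraph V) (n : ℕ) : Finset (Fin (n + 1) → V) :=
  {x | IsNBWalk G x ∧ x 0 = x (Fin.last n)}

open Classical in
/-- Closed non-backtracking walks of length `n` that are also non-backtracking at the base point. -/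
noncomputable def cyclicNB (G : SimpleGraph V) (n : ℕ) : Finset (Fin (n + 1) → V) :=
  {x ∈ closedNB G n | ∀ h : 0 < n, x ⟨1, by omega⟩ ≠ x ⟨n - 1, by omega⟩}

open Classical in
theorem sum_nbDart_le_card_closedNB (G : SimpleGraph V) (j : ℕ) :
    ∑ v, ∑ b, nbDart G j v b v ≤ (closedNB G (j + 1)).card := by
  rw [← Finset.sum_product']
  calc ∑ p ∈ (Finset.univ : Finset V) ×ˢ (Finset.univ : Finset V), nbDart G j p.1 p.2 p.1
      ≤ ∑ p ∈ (Finset.univ : Finset V) ×ˢ (Finset.univ : Finset V),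
          (Finset.univ.filter fun x : Fin (j + 2) → V => IsNBWalk G x ∧
          x ⟨0, by omega⟩ = p.1 ∧ x ⟨j, by omega⟩ = p.2 ∧ x ⟨j + 1, by omega⟩ = p.1).card :=
        Finset.sum_le_sum fun p _ => nbDart_le_card G j _ _ _
    _ = _ := (Finset.card_sigma _ _).symm
    _ ≤ _ := by
        refine Finset.card_le_card_of_injOn (fun y => y.2) ?_ ?_
        · rintro ⟨⟨v, b⟩, x⟩ hx
          simp only [Finset.coe_sigma, Set.mem_sigma_iff, Finset.mem_coe, Finset.mem_filter,
            Finset.mem_univ, true_and] at hx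
          simp only [closedNB, Finset.mem_coe, Finset.mem_filter, Finset.mem_univ, true_and]
          exact ⟨hx.2.1, hx.2.2.1.trans hx.2.2.2.2.symm⟩
        · rintro ⟨⟨v, b⟩, x⟩ hx ⟨⟨v', b'⟩, x'⟩ hx' heq
          simp only [Finset.coe_sigma, Set.mem_sigma_iff, Finset.mem_coe, Finset.mem_filter,
            Finset.mem_univ, true_and] at hx hx' heq
          subst heq
          obtain rfl : v = v' := hx.2.2.1.symm.trans hx'.2.2.1
          obtain rfl : b = b' := hx.2.2.2.1.symm.trans hx'.2.2.2.1
          rfl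

theorem closedNB_one (G : SimpleGraph V) : closedNB G 1 = ∅ := by
  classical
  rw [closedNB, Finset.filter_eq_empty_iff]
  rintro x - ⟨hx, h⟩
  have := hx.1 0 (by omega)
  exact this.ne h

theorem closedNB_two (G : SimpleGraph V) : closedNB G 2 = ∅ := by
  classical
  rw [closedNB, Finset.filter_eq_empty_iff]
  rintro x - ⟨hx, h⟩
  exact hx.2 0 (by omega) h

-- If a closed walk backtracks at its base point, cutting off both end steps leaves a closed walk
-- shorter by two, and the lost base point is one of at most `d` neighbours of the new one.
open Classical in
theorem card_closedNB_add_three_le (G : SimpleGraph V) {d : ℕ} (hd : ∀ v, G.degree v ≤ d) (k : ℕ) :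
    (closedNB G (k + 3)).card ≤ (cyclicNB G (k + 3)).card + d * (closedNB G (k + 1)).card := by
  rw [← Finset.card_filter_add_card_filter_not (s := closedNB G (k + 3))
    (fun x => ∀ h : 0 < k + 3, x ⟨1, by omega⟩ ≠ x ⟨k + 3 - 1, by omega⟩)]
  refine Nat.add_le_add_left ?_ _
  calc _ ≤ ((closedNB G (k + 1)).sigma fun y => G.neighborFinset (y 0)).card := by
        refine Finset.card_le_card_of_injOn
          (fun x => ⟨fun i : Fin (k + 2) => x ⟨i + 1, by omega⟩, x 0⟩) ?_ ?_
        · intro x hx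
          simp only [Finset.mem_coe, Finset.mem_filter, closedNB, Finset.mem_univ, true_and] at hx
          obtain ⟨⟨hx, h0⟩, h1⟩ := hx
          simp only [Finset.mem_coe, Finset.mem_sigma, closedNB, Finset.mem_filter,
            Finset.mem_univ, true_and, SimpleGraph.mem_neighborFinset]
          refine ⟨⟨⟨fun i hi => hx.1 (i + 1) (by omega),
            fun i hi => hx.2 (i + 1) (by omega)⟩, ?_⟩, ?_⟩
          · push Not at h1
            obtain ⟨-, h1⟩ := h1
            exact h1
          · exact (hx.1 0 (by omega)).symm
        · intro x hx x' hx' heq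
          simp only [Finset.mem_coe, Finset.mem_filter, closedNB, Finset.mem_univ, true_and]
            at hx hx'
          simp only [Sigma.mk.injEq, heq_eq_eq] at heq
          obtain ⟨h1, h2⟩ := heq
          funext ⟨i, hi⟩
          rcases Nat.eq_zero_or_pos i with rfl | hpos
          · exact h2
          · rcases Nat.lt_or_ge i (k + 3) with h | h
            · obtain ⟨i, rfl⟩ : ∃ i', i = i' + 1 := ⟨i - 1, by omega⟩
              exact congrFun h1 ⟨i, by omega⟩
            · obtain rfl : i = k + 3 := by omega
              exact hx.1.2.symm.trans (h2.trans hx'.1.2)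
    _ = ∑ y ∈ closedNB G (k + 1), (G.neighborFinset (y 0)).card := Finset.card_sigma _ _
    _ ≤ (closedNB G (k + 1)).card * d := by
        rw [← smul_eq_mul]
        exact Finset.sum_le_card_nsmul _ _ _ fun y _ => hd _
    _ = _ := mul_comm _ _

-- Tails are stripped until the walk is cyclically non-backtracking; lengths `1` and `2` do not
-- occur. The bound is crude, but `d` is later smaller than every power of `n`.
open Classical in
theorem card_closedNB_le (G : SimpleGraph V) {d : ℕ} (hd : ∀ v, G.degree v ≤ d) (hd1 : 1 ≤ d)
    (B j : ℕ) (hB : ∀ i ≤ j, (cyclicNB G (i + 1)).card ≤ B) :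
    (closedNB G (j + 1)).card ≤ (j + 1) * d ^ (j + 1) * B := by
  induction j using Nat.strong_induction_on with
  | _ j ih =>
    match j with
    | 0 => simp [closedNB_one]
    | 1 => simp [closedNB_two]
    | k + 2 =>
      have h1 := card_closedNB_add_three_le G hd k
      have h2 := ih k (by omega) fun i hi => hB i (by omega)
      have h3 := hB (k + 2) le_rfl
      calc (closedNB G (k + 3)).card ≤ B + d * ((k + 1) * d ^ (k + 1) * B) := by
            refine h1.trans (add_le_add h3 (Nat.mul_le_mul_left _ h2))
        _ = B * 1 + (k + 1) * B * d ^ (k + 2) := by ring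
        _ ≤ B * d ^ (k + 3) + (k + 1) * B * d ^ (k + 3) := by
            gcongr
            · exact Nat.one_le_pow _ _ hd1
            · simp
        _ ≤ B * d ^ (k + 3) + (k + 1) * B * d ^ (k + 3) + B * d ^ (k + 3) := Nat.le_add_right _ _
        _ = _ := by ring

open Classical in
theorem abs_nbTrace_zero_le (G : SimpleGraph V) (σ : V → ZMod 2) (j : ℕ) :
    |nbTrace G σ 0 (j + 1)| ≤ (closedNB G (j + 1)).card := by
  have h0 : nbTrace G σ 0 (j + 1) = ∑ v with σ v = 0, ∑ b, (nbDart G j v b v : ℝ) := by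
    simp [nbTrace, nbMatrix]
  have h1 : 0 ≤ nbTrace G σ 0 (j + 1) := by rw [h0]; positivity
  rw [abs_of_nonneg h1, h0]
  calc _ ≤ ∑ v, ∑ b, (nbDart G j v b v : ℝ) :=
        Finset.sum_le_sum_of_subset_of_nonneg (Finset.subset_univ _) fun _ _ _ => by positivity
    _ ≤ _ := by exact_mod_cast sum_nbDart_le_card_closedNB G j

end ClosedWalks

/-! ### Moments of the number of cyclically non-backtracking walks. -/

section Moments

/-- A further entry either repeats one of at most `k` earlier values, at no cost, or is one of at
most `|V|` new values, at cost `p`. -/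
theorem sum_pow_card_image_fin_le {V : Type*} [Fintype V] [DecidableEq V]
    {p : ℝ} (hp : 0 ≤ p) (k : ℕ) :
    ∑ x : Fin k → V, p ^ (Finset.univ.image x).card ≤ (k + Fintype.card V * p) ^ k := by
  induction k with
  | zero => simp
  | succ k ih =>
    rw [← (Fin.consEquiv fun _ => V).sum_comp, Fintype.sum_prod_type_right]
    have hstep : ∀ y : Fin k → V, ∑ v : V,
        p ^ (Finset.univ.image ((Fin.consEquiv fun _ => V) (v, y))).card ≤
          p ^ (Finset.univ.image y).card * (k + Fintype.card V * p) := by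
      intro y
      have hle : (Finset.univ.image y).card ≤ k := by
        simpa using Finset.card_image_le (s := Finset.univ) (f := y)
      have him : ∀ v, Finset.univ.image ((Fin.consEquiv fun _ => V) (v, y)) =
          insert v (Finset.univ.image y) := by
        intro v
        ext w
        simp [Fin.exists_fin_succ, eq_comm, Fin.consEquiv]
      calc _ ≤ ∑ v : V, ((if v ∈ Finset.univ.image y then p ^ (Finset.univ.image y).card else 0) +
            p ^ (Finset.univ.image y).card * p) := by
            refine Finset.sum_le_sum fun v _ => ?_
            rw [him]
            split_ifs with h
            · rw [Finset.insert_eq_of_mem h]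
              exact le_add_of_nonneg_right (by positivity)
            · rw [Finset.card_insert_of_notMem h, pow_succ, zero_add]
        _ = p ^ (Finset.univ.image y).card *
            ((Finset.univ.image y).card + Fintype.card V * p) := by
            rw [Finset.sum_add_distrib, ← Finset.sum_filter, Finset.sum_const, Finset.sum_const,
              Finset.filter_mem_eq_inter, Finset.univ_inter, Finset.card_univ]
            simp only [nsmul_eq_mul]
            ring
        _ ≤ _ := by gcongr
    calc _ ≤ ∑ y : Fin k → V, p ^ (Finset.univ.image y).card * (k + Fintype.card V * p) :=
          Finset.sum_le_sum fun y _ => hstep y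
      _ ≤ (k + Fintype.card V * p) ^ k * (k + Fintype.card V * p) := by
          rw [← Finset.sum_mul]
          gcongr
      _ = (k + Fintype.card V * p) ^ (k + 1) := (pow_succ _ _).symm
      _ ≤ _ := by
          gcongr
          simp

theorem sum_pow_card_image_le {ι V : Type*} [Fintype ι] [DecidableEq ι] [Fintype V] [DecidableEq V]
    {p : ℝ} (hp : 0 ≤ p) :
    ∑ x : ι → V, p ^ (Finset.univ.image x).card ≤
      (Fintype.card ι + Fintype.card V * p) ^ Fintype.card ι := by
  refine le_trans (le_of_eq ?_) (sum_pow_card_image_fin_le (V := V) hp (Fintype.card ι))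
  refine Fintype.sum_equiv ((Fintype.equivFin ι).arrowCongr (Equiv.refl V)) _ _ fun x => ?_
  congr 2
  ext w
  simp only [Finset.mem_image, Finset.mem_univ, true_and, Equiv.arrowCongr_apply, Equiv.coe_refl,
    Function.comp, id]
  exact (Fintype.equivFin ι).exists_congr_left

/-- The vertices `a`, `b` are consecutive on the sequence `x`. -/
def IsStep {V : Type*} {n : ℕ} (x : Fin (n + 1) → V) (a b : V) : Prop :=
  ∃ (t : ℕ) (h : t + 1 < n + 1), (x ⟨t, by omega⟩ = a ∧ x ⟨t + 1, h⟩ = b) ∨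
    (x ⟨t, by omega⟩ = b ∧ x ⟨t + 1, h⟩ = a)

theorem IsStep.symm {V : Type*} {n : ℕ} {x : Fin (n + 1) → V} {a b : V} (h : IsStep x a b) :
    IsStep x b a := by
  obtain ⟨t, ht, h⟩ := h
  exact ⟨t, ht, h.symm⟩

theorem IsStep.adj {V : Type*} {G : SimpleGraph V} {n : ℕ} {x : Fin (n + 1) → V} {a b : V}
    (h : IsStep x a b) (hx : IsNBWalk G x) : G.Adj a b := by
  obtain ⟨t, ht, ⟨rfl, rfl⟩ | ⟨rfl, rfl⟩⟩ := h
  · exact hx.1 t ht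
  · exact (hx.1 t ht).symm

/-- Predecessor and successor differ in the interior because the walk does not backtrack, and at the
base point because of the cyclic condition. Hence the traversed graph has no leaves. -/
theorem exists_two_steps_of_mem_cyclicNB {V : Type*} [Fintype V] {G : SimpleGraph V} {n : ℕ}
    (hn : 0 < n) {x : Fin (n + 1) → V} (hx : x ∈ cyclicNB G n) (t : Fin (n + 1)) :
    ∃ a b, a ≠ b ∧ IsStep x (x t) a ∧ IsStep x (x t) b := by
  classical
  simp only [cyclicNB, closedNB, Finset.mem_filter, Finset.mem_univ, true_and] at hx
  obtain ⟨⟨hx, h0⟩, hc⟩ := hx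
  have hend : ∃ a b, a ≠ b ∧ IsStep x (x 0) a ∧ IsStep x (x 0) b := by
    refine ⟨_, _, hc hn, ⟨0, by omega, Or.inl ⟨rfl, rfl⟩⟩, ⟨n - 1, by omega, Or.inr ⟨rfl, ?_⟩⟩⟩
    rw [h0]
    congr 1
    ext
    simp only [Fin.val_last]
    omega
  obtain ⟨t, ht⟩ := t
  rcases Nat.eq_zero_or_pos t with rfl | hpos
  · exact hend
  · rcases Nat.lt_or_ge t n with h | h
    · obtain ⟨t, rfl⟩ : ∃ t', t = t' + 1 := ⟨t - 1, by omega⟩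
      exact ⟨_, _, hx.2 t (by omega), ⟨t, by omega, Or.inr ⟨rfl, rfl⟩⟩,
        ⟨t + 1, by omega, Or.inl ⟨rfl, rfl⟩⟩⟩
    · obtain rfl : t = n := by omega
      have : x ⟨t, ht⟩ = x 0 := h0.symm
      rw [this]
      exact hend

variable {α β : Type*} [Fintype α] [Fintype β] [DecidableEq α] [DecidableEq β]

/-- The bipartite graph with a given set of edges. -/
def graphOfEdges (H : Finset (α × β)) : SimpleGraph (α ⊕ β) where
  Adj a b := ∃ q ∈ H, (a = Sum.inl q.1 ∧ b = Sum.inr q.2) ∨ (a = Sum.inr q.2 ∧ b = Sum.inl q.1)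
  symm := ⟨fun a b h => by
    obtain ⟨q, hq, h⟩ := h
    exact ⟨q, hq, h.symm.imp And.symm And.symm⟩⟩
  loopless := ⟨fun a h => by
    obtain ⟨q, hq, ⟨h1, h2⟩ | ⟨h1, h2⟩⟩ := h <;> simp [h1] at h2⟩

omit [Fintype α] [Fintype β] [DecidableEq α] [DecidableEq β] in
theorem graphOfEdges_adj_inl_inr {H : Finset (α × β)} {u : α} {v : β} :
    (graphOfEdges H).Adj (Sum.inl u) (Sum.inr v) ↔ (u, v) ∈ H := by
  simp [graphOfEdges]

open Classical in
/-- The edges traversed by a family of vertex sequences. -/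
noncomputable def stepEdges {ι : Type*} {n : ℕ} (X : ι → Fin (n + 1) → α ⊕ β) : Finset (α × β) :=
  {q | ∃ i, IsStep (X i) (Sum.inl q.1) (Sum.inr q.2)}

omit [DecidableEq α] [DecidableEq β] in
theorem stepEdges_subset {ι : Type*} {n : ℕ} {X : ι → Fin (n + 1) → α ⊕ β} {H : Finset (α × β)}
    (hX : ∀ i, X i ∈ cyclicNB (graphOfEdges H) n) : stepEdges X ⊆ H := by
  classical
  intro q hq
  simp only [stepEdges, Finset.mem_filter, Finset.mem_univ, true_and] at hq
  obtain ⟨i, hi⟩ := hq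
  have := hX i
  simp only [cyclicNB, closedNB, Finset.mem_filter, Finset.mem_univ, true_and] at this
  exact graphOfEdges_adj_inl_inr.1 (hi.adj this.1.1)

open Classical in
/-- A union of cyclically non-backtracking closed walks has at least as many edges as vertices. -/
theorem card_image_le_card_stepEdges {ι : Type*} [Fintype ι] {n : ℕ} (hn : 0 < n)
    {X : ι → Fin (n + 1) → α ⊕ β} {H : Finset (α × β)}
    (hX : ∀ i, X i ∈ cyclicNB (graphOfEdges H) n) :
    (Finset.univ.image fun z : ι × Fin (n + 1) => X z.1 z.2).card ≤ (stepEdges X).card := by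
  have hadj : ∀ i a b, IsStep (X i) a b → (graphOfEdges H).Adj a b := by
    intro i a b h
    have := hX i
    simp only [cyclicNB, closedNB, Finset.mem_filter, Finset.mem_univ, true_and] at this
    exact h.adj this.1.1
  -- Incidences are counted twice: every visited vertex lies on at least two traversed edges, every
  -- edge has two ends.
  have := Finset.card_mul_le_card_mul (m := 2) (n := 2)
    (s := Finset.univ.image fun z : ι × Fin (n + 1) => X z.1 z.2) (t := stepEdges X)
    (fun w q => w = Sum.inl q.1 ∨ w = Sum.inr q.2) ?_ ?_
  · omega
  · intro w hw
    simp only [Finset.mem_image, Finset.mem_univ, true_and, Prod.exists] at hw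
    obtain ⟨i, t, rfl⟩ := hw
    obtain ⟨a, b, hab, ha, hb⟩ := exists_two_steps_of_mem_cyclicNB hn (hX i) t
    obtain ⟨q, -, hq⟩ := hadj i _ _ ha
    obtain ⟨r, -, hr⟩ := hadj i _ _ hb
    have hqr : q ≠ r := by
      rintro rfl
      rcases hq with ⟨h1, h2⟩ | ⟨h1, h2⟩ <;> rcases hr with ⟨h3, h4⟩ | ⟨h3, h4⟩
      · exact hab (h2.trans h4.symm)
      · simp [h1] at h3
      · simp [h1] at h3
      · exact hab (h2.trans h4.symm)
    have hmem : ∀ (q : α × β) (a : α ⊕ β), IsStep (X i) (X i t) a →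
        ((X i t = Sum.inl q.1 ∧ a = Sum.inr q.2) ∨ (X i t = Sum.inr q.2 ∧ a = Sum.inl q.1)) →
        q ∈ (stepEdges X).bipartiteAbove (fun w q => w = Sum.inl q.1 ∨ w = Sum.inr q.2)
          (X i t) := by
      intro q a ha hq
      simp only [Finset.bipartiteAbove, stepEdges, Finset.mem_filter, Finset.mem_univ, true_and]
      rcases hq with ⟨h1, h2⟩ | ⟨h1, h2⟩
      · exact ⟨⟨i, by rw [← h1, ← h2]; exact ha⟩, Or.inl h1⟩
      · exact ⟨⟨i, by rw [← h1, ← h2]; exact ha.symm⟩, Or.inr h1⟩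
    rw [← Finset.card_pair hqr]
    refine Finset.card_le_card ?_
    rw [Finset.insert_subset_iff, Finset.singleton_subset_iff]
    exact ⟨hmem q a ha hq, hmem r b hb hr⟩
  · intro q _
    refine le_trans (Finset.card_le_card (t := {Sum.inl q.1, Sum.inr q.2}) ?_) Finset.card_le_two
    intro w hw
    simpa using (Finset.mem_filter.1 hw).2

open Classical in
/-- Moments of the number of cyclically non-backtracking closed walks in a biregular graph. -/
theorem sum_card_cyclicNB_pow_le (l d n s : ℕ) (hn : 0 < n) {p : ℝ} (hp0 : 0 ≤ p)
    (hp : (l * d : ℝ) ≤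
      p * ((Fintype.card β * d : ℝ) - (2 * (l * d) + (s * (n + 1) : ℕ))))
    (hK : 2 * (l * d) + s * (n + 1) < Fintype.card β * d) :
    ∑ H ∈ biregularSets α β l d, ((cyclicNB (graphOfEdges H) n).card : ℝ) ^ s ≤
      (biregularSets α β l d).card *
        ((s * (n + 1) : ℕ) + (Fintype.card α + Fintype.card β) * p) ^ (s * (n + 1)) := by
  have h1 : ∀ H : Finset (α × β), ((cyclicNB (graphOfEdges H) n).card : ℝ) ^ s =
      ∑ X : Fin s → Fin (n + 1) → α ⊕ β,
        if ∀ i, X i ∈ cyclicNB (graphOfEdges H) n then (1 : ℝ) else 0 := by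
    intro H
    rw [Finset.sum_boole, ← Nat.cast_pow]
    congr 1
    have := Fintype.card_piFinset_const (cyclicNB (graphOfEdges H) n) s
    rw [← this]
    congr 1
    ext X
    simp [Fintype.mem_piFinset]
  have h2 : ∀ X : Fin s → Fin (n + 1) → α ⊕ β,
      (∑ H ∈ biregularSets α β l d,
        if ∀ i, X i ∈ cyclicNB (graphOfEdges H) n then (1 : ℝ) else 0) ≤
      p ^ (Finset.univ.image fun z : Fin s × Fin (n + 1) => X z.1 z.2).card *
        (biregularSets α β l d).card := by
    intro X
    rw [Finset.sum_boole]
    rcases ((biregularSets α β l d).filter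
      fun H => ∀ i, X i ∈ cyclicNB (graphOfEdges H) n).eq_empty_or_nonempty with h | ⟨H, hH⟩
    · rw [h]
      simp only [Finset.card_empty, Nat.cast_zero]
      positivity
    · have hX := (Finset.mem_filter.1 hH).2
      -- Keeping exactly as many edges as there are vertices makes the exponent of `p` the number of
      -- vertices, without assuming `p ≤ 1`.
      obtain ⟨F, hF, hFc⟩ := Finset.exists_subset_card_eq (card_image_le_card_stepEdges hn hX)
      rw [← hFc]
      refine le_trans ?_ (card_biregularSets_superset_le l d (s * (n + 1)) p
        (by exact_mod_cast hp) hp0 hK F ?_)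
      · gcongr with H' hH'
        intro hX'
        exact hF.trans (stepEdges_subset hX')
      · rw [hFc]
        simpa using Finset.card_image_le (s := Finset.univ)
          (f := fun z : Fin s × Fin (n + 1) => X z.1 z.2)
  simp_rw [h1]
  rw [Finset.sum_comm]
  calc _ ≤ ∑ X : Fin s → Fin (n + 1) → α ⊕ β,
        p ^ (Finset.univ.image fun z : Fin s × Fin (n + 1) => X z.1 z.2).card *
        (biregularSets α β l d).card := Finset.sum_le_sum fun X _ => h2 X
    _ = (∑ x : Fin s × Fin (n + 1) → α ⊕ β, p ^ (Finset.univ.image x).card) *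
        (biregularSets α β l d).card := by
        rw [← Finset.sum_mul]
        congr 1
        refine Fintype.sum_equiv (Equiv.curry _ _ _).symm _ _ fun X => rfl
    _ ≤ _ := by
        rw [mul_comm]
        gcongr
        have := sum_pow_card_image_le (ι := Fin s × Fin (n + 1)) (V := α ⊕ β) hp0
        simpa using this

end Moments

/-! ### Transfer to the uniform measure and a tail bound. -/

section Uniform

open BiregularMP

theorem degree_graphOfEdges_inl {α β : Type*} [Fintype α] [Fintype β] [DecidableEq α]
    [DecidableEq β] (H : Finset (α × β)) (u : α)
    [Fintype ((graphOfEdges H).neighborSet (Sum.inl u))] :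
    (graphOfEdges H).degree (Sum.inl u) = (H.filter fun q => q.1 = u).card := by
  rw [← SimpleGraph.card_neighborFinset_eq_degree,
    ← Finset.card_image_of_injOn (f := fun q : α × β => (Sum.inr q.2 : α ⊕ β))
      (s := H.filter fun q => q.1 = u)]
  · congr 1
    ext w
    rw [SimpleGraph.mem_neighborFinset]
    cases w <;> simp [graphOfEdges]
  · intro q hq r hr h
    simp only [Finset.coe_filter, Set.mem_ofPred_eq] at hq hr
    exact Prod.ext (hq.2.trans hr.2.symm) (Sum.inr_injective h)

theorem degree_graphOfEdges_inr {α β : Type*} [Fintype α] [Fintype β] [DecidableEq α]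
    [DecidableEq β] (H : Finset (α × β)) (v : β)
    [Fintype ((graphOfEdges H).neighborSet (Sum.inr v))] :
    (graphOfEdges H).degree (Sum.inr v) = (H.filter fun q => q.2 = v).card := by
  rw [← SimpleGraph.card_neighborFinset_eq_degree,
    ← Finset.card_image_of_injOn (f := fun q : α × β => (Sum.inl q.1 : α ⊕ β))
      (s := H.filter fun q => q.2 = v)]
  · congr 1
    ext w
    rw [SimpleGraph.mem_neighborFinset]
    cases w <;> simp [graphOfEdges]
  · intro q hq r hr h
    simp only [Finset.coe_filter, Set.mem_ofPred_eq] at hq hr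
    exact Prod.ext (Sum.inl_injective h) (hq.2.trans hr.2.symm)

theorem graphOfEdges_injective {α β : Type*} :
    Function.Injective (graphOfEdges : Finset (α × β) → SimpleGraph (α ⊕ β)) := by
  intro H H' h
  ext ⟨u, v⟩
  rw [← graphOfEdges_adj_inl_inr, h, graphOfEdges_adj_inl_inr]

theorem isBiregular_graphOfEdges {m n l d : ℕ} (H : Finset (Fin m × Fin n)) :
    IsBiregular l d (graphOfEdges H) ↔ H ∈ biregularSets (Fin m) (Fin n) l d := by
  rw [mem_biregularSets]
  constructor
  · rintro ⟨-, h1, h2⟩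
    exact ⟨fun u => by rw [← h1 u, degree_graphOfEdges_inl],
      fun v => by rw [← h2 v, degree_graphOfEdges_inr]⟩
  · rintro ⟨h1, h2⟩
    refine ⟨⟨?_, ?_⟩, fun u => by rw [← h1 u, degree_graphOfEdges_inl],
      fun v => by rw [← h2 v, degree_graphOfEdges_inr]⟩
    · rw [Set.disjoint_left]
      rintro _ ⟨a, rfl⟩ ⟨b, hb⟩
      cases hb
    · rintro a b ⟨q, -, ⟨rfl, rfl⟩ | ⟨rfl, rfl⟩⟩
      · exact Or.inl ⟨⟨_, rfl⟩, ⟨_, rfl⟩⟩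
      · exact Or.inr ⟨⟨_, rfl⟩, ⟨_, rfl⟩⟩

theorem BiregularMP.IsBiregular.exists_graphOfEdges {m n l d : ℕ}
    {G : SimpleGraph (Fin m ⊕ Fin n)} (hG : IsBiregular l d G) :
    ∃ H ∈ biregularSets (Fin m) (Fin n) l d, graphOfEdges H = G := by
  classical
  have key : graphOfEdges (Finset.univ.filter fun q : Fin m × Fin n =>
      G.Adj (Sum.inl q.1) (Sum.inr q.2)) = G := by
    ext a b
    have hb := @(hG.bipartite.mem_of_adj)
    cases a <;> cases b
    · simp only [graphOfEdges]
      simp only [reduceCtorEq, and_false, false_and, or_self, exists_false, false_iff]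
      intro h
      have := hb h
      simp at this
    · rw [graphOfEdges_adj_inl_inr]; simp
    · rw [SimpleGraph.adj_comm, graphOfEdges_adj_inl_inr, SimpleGraph.adj_comm]; simp
    · simp only [graphOfEdges]
      simp only [reduceCtorEq, and_false, false_and, or_self, exists_false, false_iff]
      intro h
      have := hb h
      simp at this
  refine ⟨_, ?_, key⟩
  rw [← isBiregular_graphOfEdges, key]
  exact hG

theorem BiregularMP.IsBiregular.card_mul_eq {m n l d : ℕ}
    {G : SimpleGraph (Fin m ⊕ Fin n)} (hG : IsBiregular l d G) : m * l = n * d := by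
  obtain ⟨H, hH, -⟩ := hG.exists_graphOfEdges
  have h1 := card_of_mem_biregularSets hH
  have h2 : H.card = m * l := by
    rw [Finset.card_eq_sum_card_fiberwise (f := Prod.fst) (t := Finset.univ) (by simp),
      Finset.sum_congr rfl fun v _ => (mem_biregularSets.1 hH).1 v]
    simp
  rw [h2, Fintype.card_fin] at h1
  exact h1

open Classical in
theorem setOf_isBiregular_eq (m n l d : ℕ) :
    {G : SimpleGraph (Fin m ⊕ Fin n) | IsBiregular l d G} =
      ((biregularSets (Fin m) (Fin n) l d).image graphOfEdges :
        Finset (SimpleGraph (Fin m ⊕ Fin n))) := by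
  ext G
  simp only [Set.mem_ofPred_eq, Finset.coe_image, Set.mem_image, Finset.mem_coe]
  constructor
  · exact fun h => h.exists_graphOfEdges
  · rintro ⟨H, hH, rfl⟩
    exact (isBiregular_graphOfEdges H).2 hH

theorem measurableSingletonClass_simpleGraph (V : Type*) [Countable V] :
    MeasurableSingletonClass (SimpleGraph V) := by
  refine ⟨fun G => ?_⟩
  have : ({G} : Set (SimpleGraph V)) = SimpleGraph.Adj ⁻¹' {G.Adj} := by
    ext G'
    simp only [Set.mem_singleton_iff, Set.mem_preimage]
    exact ⟨fun h => h ▸ rfl, fun h => SimpleGraph.ext h⟩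
  rw [this]
  exact SimpleGraph.measurable_adj (measurableSet_singleton _)

theorem uniformBiregular_apply (m n l d : ℕ) (S : Set (SimpleGraph (Fin m ⊕ Fin n)))
    [DecidablePred fun H : Finset (Fin m × Fin n) => graphOfEdges H ∈ S] :
    uniformBiregular m n l d S =
      (((biregularSets (Fin m) (Fin n) l d).filter fun H => graphOfEdges H ∈ S).card : ENNReal) /
        ((biregularSets (Fin m) (Fin n) l d).card : ENNReal) := by
  classical
  have := measurableSingletonClass_simpleGraph (Fin m ⊕ Fin n)
  have hfin : {G : SimpleGraph (Fin m ⊕ Fin n) | IsBiregular l d G}.Finite := Set.toFinite _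
  rw [uniformBiregular, ← ProbabilityTheory.uniformOn_inter_self hfin]
  have hS : {G : SimpleGraph (Fin m ⊕ Fin n) | IsBiregular l d G} ∩ S =
      (((biregularSets (Fin m) (Fin n) l d).filter fun H => graphOfEdges H ∈ S).image graphOfEdges :
        Finset (SimpleGraph (Fin m ⊕ Fin n))) := by
    rw [setOf_isBiregular_eq]
    ext G
    simp only [Finset.coe_image, Set.mem_inter_iff, Set.mem_image, Finset.mem_coe,
      Finset.mem_filter]
    constructor
    · rintro ⟨⟨H, hH, rfl⟩, h⟩; exact ⟨H, ⟨hH, h⟩, rfl⟩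
    · rintro ⟨H, ⟨hH, h⟩, rfl⟩; exact ⟨⟨H, hH, rfl⟩, h⟩
  rw [hS, setOf_isBiregular_eq, ProbabilityTheory.uniformOn_apply_finset,
    Finset.inter_eq_right.2 (Finset.image_subset_image (Finset.filter_subset _ _)),
    Finset.card_image_of_injective _ graphOfEdges_injective,
    Finset.card_image_of_injective _ graphOfEdges_injective]

/-- Biregular graphs rarely have many cyclically non-backtracking closed walks of length `j`. -/
theorem uniformBiregular_card_cyclicNB_le {m n l d j : ℕ} (hj : 0 < j) (hld : l ≤ d) (hd : 0 < d)
    (hml : m * l = n * d) (hn : 4 * d + 2 * (10 * (j + 1)) < n)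
    (hpow : (10 * (j + 1) + 4 * d) ^ (10 * (j + 1)) ≤ n) :
    uniformBiregular m n l d {G | n < (cyclicNB G j).card ^ 2} ≤
      ENNReal.ofReal (((n : ℝ) ^ 4)⁻¹) := by
  classical
  set K := 10 * (j + 1) with hKdef
  have hn0 : (0 : ℝ) < n := by
    have : 0 < n := by omega
    exact_mod_cast this
  set Γ := biregularSets (Fin m) (Fin n) l d
  rcases Γ.eq_empty_or_nonempty with hΓ | hΓ
  · rw [uniformBiregular_apply]
    change ((Γ.filter _).card : ENNReal) / (Γ.card : ENNReal) ≤ _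
    simp [hΓ]
  have h1 : 2 * (l * d) + K < n * d := by
    have e1 : l * d ≤ d * d := Nat.mul_le_mul_right d hld
    have e2 : K ≤ K * d := Nat.le_mul_of_pos_right K hd
    calc 2 * (l * d) + K ≤ 2 * (d * d) + K * d := by omega
      _ = (2 * d + K) * d := by ring
      _ < n * d := Nat.mul_lt_mul_of_pos_right (by omega) hd
  have h2 : (2 * (2 * (l * d) + K) : ℝ) ≤ n * d := by
    have : 2 * (2 * (l * d) + K) ≤ n * d := by
      have e1 : l * d ≤ d * d := Nat.mul_le_mul_right d hld
      have e2 : K ≤ K * d := Nat.le_mul_of_pos_right K hd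
      calc 2 * (2 * (l * d) + K) ≤ 4 * (d * d) + 2 * (K * d) := by omega
        _ = (4 * d + 2 * K) * d := by ring
        _ ≤ n * d := Nat.mul_le_mul_right _ (by omega)
    exact_mod_cast this
  -- By `h2` the loss in the switching estimate is at most half of `n * d`, so `p = 2 l / n` is
  -- admissible. Since `m l = n d`, the quantity `(m + n) p` is at most `4 d`.
  have hmom := sum_card_cyclicNB_pow_le (α := Fin m) (β := Fin n) l d j 10 hj
    (p := 2 * l / n) (by positivity) (by
      simp only [Fintype.card_fin]
      rw [div_mul_eq_mul_div, le_div_iff₀ hn0, ← hKdef]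
      have : (0 : ℝ) ≤ l := Nat.cast_nonneg l
      nlinarith) (by simpa using h1)
  simp only [Fintype.card_fin, ← hKdef] at hmom
  have hbase : (K + ((m : ℝ) + n) * (2 * l / n)) ≤ K + 4 * d := by
    have e : (m : ℝ) * l = n * d := by exact_mod_cast hml
    have e' : ((m : ℝ) + n) * (2 * l / n) = 2 * d + 2 * l := by
      field_simp
      linear_combination e
    have : (l : ℝ) ≤ d := by exact_mod_cast hld
    rw [e']
    linarith
  have hbound : (K + ((m : ℝ) + n) * (2 * l / n)) ^ K ≤ n := by
    calc _ ≤ ((K : ℝ) + 4 * d) ^ K := by gcongr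
      _ ≤ n := by exact_mod_cast hpow
  -- Markov's inequality: a count above `√n` has tenth power above `n ^ 5`, while the tenth moment
  -- is at most `n`.
  have hmarkov : ((Γ.filter fun H => n < (cyclicNB (graphOfEdges H) j).card ^ 2).card : ℝ) *
      (n : ℝ) ^ 5 ≤ Γ.card * n := by
    calc _ ≤ ∑ H ∈ Γ.filter fun H => n < (cyclicNB (graphOfEdges H) j).card ^ 2,
          ((cyclicNB (graphOfEdges H) j).card : ℝ) ^ 10 := by
          rw [← nsmul_eq_mul]
          refine Finset.card_nsmul_le_sum _ _ _ fun H hH => ?_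
          have h := (Finset.mem_filter.1 hH).2
          have h' : (n : ℝ) ≤ ((cyclicNB (graphOfEdges H) j).card : ℝ) ^ 2 := by
            exact_mod_cast h.le
          calc (n : ℝ) ^ 5 ≤ (((cyclicNB (graphOfEdges H) j).card : ℝ) ^ 2) ^ 5 := by gcongr
            _ = _ := by ring
      _ ≤ ∑ H ∈ Γ, ((cyclicNB (graphOfEdges H) j).card : ℝ) ^ 10 :=
          Finset.sum_le_sum_of_subset_of_nonneg (Finset.filter_subset _ _)
            fun _ _ _ => by positivity
      _ ≤ Γ.card * (K + ((m : ℝ) + n) * (2 * l / n)) ^ K := hmom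
      _ ≤ Γ.card * n := by gcongr
  have hΓ0 : (0 : ℝ) < Γ.card := by exact_mod_cast hΓ.card_pos
  rw [uniformBiregular_apply]
  have hq : ∀ a b : ℕ, 0 < b → (a : ENNReal) / (b : ENNReal) = ENNReal.ofReal ((a : ℝ) / b) := by
    intro a b hb
    rw [ENNReal.ofReal_div_of_pos (by exact_mod_cast hb)]
    simp
  rw [hq _ _ hΓ.card_pos]
  refine ENNReal.ofReal_le_ofReal ?_
  rw [div_le_iff₀ hΓ0, inv_mul_eq_div, le_div_iff₀ (by positivity)]
  refine le_of_mul_le_mul_right ?_ hn0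
  calc _ = ((Γ.filter fun H => n < (cyclicNB (graphOfEdges H) j).card ^ 2).card : ℝ) *
        (n : ℝ) ^ 5 := by
        simp only [Set.mem_ofPred_eq]
        ring
    _ ≤ _ := hmarkov

end Uniform

/-! ### Spectral moments as traces, and their limits. -/

section Limit

open BiregularMP

theorem Matrix.IsHermitian.trace_pow_eq_sum_eigenvalues_pow {V : Type*} [Fintype V] [DecidableEq V]
    {M : Matrix V V ℝ} (hM : M.IsHermitian) (k : ℕ) :
    (M ^ k).trace = ∑ v, hM.eigenvalues v ^ k := by
  have h := hM.spectral_theorem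
  conv_lhs => rw [h, ← map_pow, Matrix.diagonal_pow]
  rw [Unitary.conjStarAlgAut_apply, Matrix.trace_mul_cycle]
  simp [Matrix.trace]

theorem integral_pow_esd {V : Type*} [Fintype V] [DecidableEq V] {M : Matrix V V ℝ}
    (hM : M.IsHermitian) (k : ℕ) :
    ∫ x, x ^ k ∂(esd hM) = (Fintype.card V : ℝ)⁻¹ * (M ^ k).trace := by
  rw [esd, MeasureTheory.integral_smul_measure, MeasureTheory.integral_finsetSum_measure,
    hM.trace_pow_eq_sum_eigenvalues_pow]
  · simp [MeasureTheory.integral_dirac]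
  · intro v _
    exact MeasureTheory.integrable_dirac (by simp)

/-- The side of a vertex: `0` for right vertices and `1` for left vertices. -/
def side {α β : Type*} : α ⊕ β → ZMod 2 := Sum.elim (fun _ => 1) fun _ => 0

theorem BiregularMP.IsBiregular.side_adj {m n l d : ℕ} {G : SimpleGraph (Fin m ⊕ Fin n)}
    (hG : IsBiregular l d G) (a b : Fin m ⊕ Fin n) (h : G.Adj a b) : side b = side a + 1 := by
  rcases hG.bipartite.mem_of_adj h with ⟨⟨a, rfl⟩, ⟨b, rfl⟩⟩ | ⟨⟨a, rfl⟩, ⟨b, rfl⟩⟩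
  · simp only [side, Sum.elim_inl, Sum.elim_inr]; rfl
  · simp [side]

open Classical in
theorem BiregularMP.IsBiregular.degree_of_side_eq_zero {m n l d : ℕ}
    {G : SimpleGraph (Fin m ⊕ Fin n)} (hG : IsBiregular l d G) (w : Fin m ⊕ Fin n)
    (hw : side w = 0) : G.degree w = d := by
  cases w with
  | inl u => simp [side] at hw
  | inr v => convert hG.degree_right v

open Classical in
theorem BiregularMP.IsBiregular.degree_of_side_eq_one {m n l d : ℕ}
    {G : SimpleGraph (Fin m ⊕ Fin n)} (hG : IsBiregular l d G) (w : Fin m ⊕ Fin n)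
    (hw : side w = 1) : G.degree w = l := by
  cases w with
  | inl u => convert hG.degree_left u
  | inr v => simp [side] at hw

theorem integral_pow_odd_esd_scaledAdj {m n l d : ℕ} {G : SimpleGraph (Fin m ⊕ Fin n)}
    (hG : IsBiregular l d G) (k : ℕ) :
    ∫ x, x ^ (2 * k + 1) ∂(esd (scaledAdj_isHermitian d G)) = 0 := by
  classical
  have h := trace_adjMatrix_pow_odd hG.side_adj k
  rw [integral_pow_esd, scaledAdj, smul_pow, Matrix.trace_smul]
  convert mul_zero _
  convert smul_zero _
  convert h

theorem integral_pow_even_esd_scaledAdj {m n l d : ℕ} {G : SimpleGraph (Fin m ⊕ Fin n)}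
    (hG : IsBiregular l d G) (k : ℕ) :
    ∫ x, x ^ (2 * (k + 1)) ∂(esd (scaledAdj_isHermitian d G)) =
      ((m : ℝ) + n)⁻¹ * (((Real.sqrt d)⁻¹) ^ (2 * (k + 1)) *
        (2 * nbTrace G side (2 * (k + 1)) 0)) := by
  classical
  have h := trace_adjMatrix_pow_succ hG.side_adj (2 * k + 1)
  rw [integral_pow_esd, scaledAdj, smul_pow, Matrix.trace_smul, smul_eq_mul,
    show 2 * (k + 1) = 2 * k + 1 + 1 by ring, ← h]
  simp only [Fintype.card_sum, Fintype.card_fin]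
  push_cast
  congr!

open Classical in
theorem nbTrace_zero_zero {V : Type*} [Fintype V] (G : SimpleGraph V) (σ : V → ZMod 2) :
    nbTrace G σ 0 0 = (Finset.univ.filter fun v => σ v = 0).card := by
  simp [nbTrace, nbMatrix]

/-- Weighted counts of lattice paths from height `0` to height `j`, with weights `1` and `c` on
the down steps from odd and from even heights. -/
noncomputable def alternatingPaths (c : ℝ) : ℕ → ℕ → ℝ
  | 0, 0 => 1
  | 0, _ + 1 => 0
  | a + 1, 0 => alternatingPaths c a 1
  | a + 1, j + 1 => alternatingPaths c a (j + 2) +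
      (if Even j then 1 else c) * alternatingPaths c a j

theorem alternatingPaths_eq_sum_narayana {c : ℝ} (hc : c ≠ 0) (k : ℕ) :
    alternatingPaths c (2 * (k + 1)) 0 =
      ∑ r ∈ Finset.range (k + 1), c ^ r * narayana (k + 1) r := by
  refine sum_narayana_of_alternating_recurrence hc (alternatingPaths c) ?_ ?_ ?_ ?_ ?_ k
  · simp [alternatingPaths]
  · intro j; simp [alternatingPaths]
  · intro a; rw [alternatingPaths]
  · intro a i; rw [alternatingPaths]; simp
  · intro a i; rw [alternatingPaths]; simp

/-- Induction on `a`. For `a = 0` only `j = 0` survives, with the `n` right vertices giving limit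
`1`. In the recurrence the coefficients divided by `d` are `1`, `1 - 1 / d` and `l / d - 1 / d`,
with limits `1`, `1` and `c`. -/
theorem tendsto_nbTrace {m n l d : ℕ → ℕ} {c : ℝ} (G : ∀ i, SimpleGraph (Fin (m i) ⊕ Fin (n i)))
    (hG : ∀ i, IsBiregular (l i) (d i) (G i)) (hd : Tendsto d atTop atTop)
    (hn : Tendsto n atTop atTop)
    (hc : Tendsto (fun i => (l i : ℝ) / (d i : ℝ)) atTop (𝓝 c))
    (h0 : ∀ j, Tendsto (fun i => nbTrace (G i) side 0 (j + 1) /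
      (n i * Real.sqrt (d i) ^ (j + 1))) atTop (𝓝 0)) (a j : ℕ) :
    Tendsto (fun i => nbTrace (G i) side a j / (n i * Real.sqrt (d i) ^ (a + j))) atTop
      (𝓝 (alternatingPaths c a j)) := by
  classical
  have hdinv : Tendsto (fun i => ((d i : ℝ))⁻¹) atTop (𝓝 0) :=
    tendsto_inv_atTop_zero.comp (tendsto_natCast_atTop_atTop.comp hd)
  have hpos : ∀ᶠ i in atTop, 0 < n i ∧ 0 < d i :=
    (hn.eventually_gt_atTop 0).and (hd.eventually_gt_atTop 0)
  induction a generalizing j with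
  | zero =>
    cases j with
    | zero =>
      simp only [alternatingPaths]
      refine tendsto_const_nhds.congr' ?_
      filter_upwards [hpos] with i hi
      have : (Finset.univ.filter fun v : Fin (m i) ⊕ Fin (n i) => side v = 0).card = n i := by
        have e : (Finset.univ.filter fun v : Fin (m i) ⊕ Fin (n i) => side v = 0) =
            Finset.univ.map ⟨Sum.inr, Sum.inr_injective⟩ := by
          ext v
          rw [Finset.mem_filter]
          cases v <;> simp [side]
        rw [e, Finset.card_map, Finset.card_univ, Fintype.card_fin]
      have hn0 : (n i : ℝ) ≠ 0 := by exact_mod_cast hi.1.ne'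
      rw [nbTrace_zero_zero, this]
      simp [hn0]
    | succ j => simpa [alternatingPaths] using h0 j
  | succ a ih =>
    match j with
    | 0 =>
      simp only [alternatingPaths]
      refine (ih 1).congr fun i => ?_
      rw [nbTrace_succ_zero]
    | 1 =>
      have hlim := (ih 2).add (ih 0)
      rw [show alternatingPaths c (a + 1) 1 = alternatingPaths c a 2 + alternatingPaths c a 0 by
        rw [alternatingPaths]; simp]
      refine hlim.congr' ?_
      filter_upwards [hpos] with i hi
      rw [nbTrace_succ_one (hG i).side_adj (hG i).degree_of_side_eq_zero]
      have hn0 : (n i : ℝ) ≠ 0 := by exact_mod_cast hi.1.ne'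
      have hd0 : (0 : ℝ) < d i := by exact_mod_cast hi.2
      have hs0 : Real.sqrt (d i) ≠ 0 := (Real.sqrt_pos.2 hd0).ne'
      have hs : (d i : ℝ) = Real.sqrt (d i) ^ 2 := (Real.sq_sqrt hd0.le).symm
      rw [hs, Real.sqrt_sq (Real.sqrt_nonneg _), show a + 1 + 1 = a + 2 by ring,
        show a + 0 = a by ring]
      field_simp
      ring
    | j + 2 =>
      have key : ∀ γ : ℕ → ℝ, Tendsto (fun i => γ i / d i) atTop
            (𝓝 (if Even (j + 1) then 1 else c)) →
          (∀ i, ∀ w : Fin (m i) ⊕ Fin (n i), side w = (j + 1 : ℕ) →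
            ((G i).degree w : ℝ) - 1 = γ i) →
          Tendsto (fun i => nbTrace (G i) side (a + 1) (j + 2) /
            (n i * Real.sqrt (d i) ^ (a + 1 + (j + 2)))) atTop
            (𝓝 (alternatingPaths c (a + 1) (j + 2))) := by
        intro γ hγ hdeg
        rw [alternatingPaths]
        refine ((ih (j + 3)).add (hγ.mul (ih (j + 1)))).congr' ?_
        filter_upwards [hpos] with i hi
        rw [nbTrace_succ_add_two (hG i).side_adj j (hdeg i)]
        have hn0 : (n i : ℝ) ≠ 0 := by exact_mod_cast hi.1.ne'
        have hd0 : (0 : ℝ) < d i := by exact_mod_cast hi.2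
        have hs0 : Real.sqrt (d i) ≠ 0 := (Real.sqrt_pos.2 hd0).ne'
        have hs : (d i : ℝ) = Real.sqrt (d i) ^ 2 := (Real.sq_sqrt hd0.le).symm
        rw [show γ i / d i = γ i / Real.sqrt (d i) ^ 2 by rw [← hs],
          show a + 1 + (j + 2) = a + (j + 1) + 2 by ring,
          show a + (j + 3) = a + (j + 1) + 2 by ring, pow_add _ (a + (j + 1)) 2]
        field_simp
      by_cases hj : Even (j + 1)
      · have hcast : ((j + 1 : ℕ) : ZMod 2) = 0 := (ZMod.natCast_eq_zero_iff_even).2 hj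
        refine key (fun i => (d i : ℝ) - 1) ?_ ?_
        · rw [if_pos hj]
          have : Tendsto (fun i => (1 : ℝ) - (d i : ℝ)⁻¹) atTop (𝓝 (1 - 0)) :=
            tendsto_const_nhds.sub hdinv
          rw [sub_zero] at this
          refine this.congr' ?_
          filter_upwards [hpos] with i hi
          have hd0 : (d i : ℝ) ≠ 0 := by exact_mod_cast hi.2.ne'
          field_simp
        · intro i w hw
          rw [(hG i).degree_of_side_eq_zero w (hw.trans hcast)]
      · have hcast : ((j + 1 : ℕ) : ZMod 2) = 1 :=
          (ZMod.natCast_eq_one_iff_odd).2 (Nat.not_even_iff_odd.1 hj)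
        refine key (fun i => (l i : ℝ) - 1) ?_ ?_
        · rw [if_neg hj]
          have : Tendsto (fun i => (l i : ℝ) / d i - (d i : ℝ)⁻¹) atTop (𝓝 (c - 0)) :=
            hc.sub hdinv
          rw [sub_zero] at this
          refine this.congr fun i => ?_
          rw [sub_div, one_div]
        · intro i w hw
          rw [(hG i).degree_of_side_eq_one w (hw.trans hcast)]

theorem tendsto_pow_div_sqrt {n d : ℕ → ℕ} (h_small : ∀ ε : ℝ, 0 < ε →
      (fun i => (d i : ℝ)) =o[atTop] fun i => (n i : ℝ) ^ ε) (k : ℕ) :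
    Tendsto (fun i => (d i : ℝ) ^ (k + 1) / Real.sqrt (n i)) atTop (𝓝 0) := by
  -- This exponent makes the power `k + 1` of the bound equal to `√n`.
  have h := (h_small (1 / (2 * (k + 1))) (by positivity)).pow (n := k + 1) (by omega)
  refine (h.tendsto_div_nhds_zero).congr fun i => ?_
  rw [← Real.rpow_natCast ((n i : ℝ) ^ _), ← Real.rpow_mul (Nat.cast_nonneg _), Real.sqrt_eq_rpow]
  congr 2
  push_cast
  field_simp

/-- With at most `√n` cyclic walks of each length, the trace is at most `(j + 1) * d ^ (j + 1) *
√n`, which is `o(n)`. -/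
theorem tendsto_nbTrace_zero_of_cyclicNB {m n l d : ℕ → ℕ}
    (G : ∀ i, SimpleGraph (Fin (m i) ⊕ Fin (n i)))
    (hG : ∀ i, IsBiregular (l i) (d i) (G i)) (hld : ∀ i, l i ≤ d i)
    (hd : Tendsto d atTop atTop) (hn : Tendsto n atTop atTop)
    (h_small : ∀ ε : ℝ, 0 < ε → (fun i => (d i : ℝ)) =o[atTop] fun i => (n i : ℝ) ^ ε)
    (hC : ∀ j, ∀ᶠ i in atTop, (cyclicNB (G i) (j + 1)).card ^ 2 ≤ n i) (j : ℕ) :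
    Tendsto (fun i => nbTrace (G i) side 0 (j + 1) /
      (n i * Real.sqrt (d i) ^ (j + 1))) atTop (𝓝 0) := by
  classical
  have hlim : Tendsto (fun i => ((j : ℝ) + 1) * ((d i : ℝ) ^ (j + 1) / Real.sqrt (n i))) atTop
      (𝓝 0) := by
    simpa using (tendsto_pow_div_sqrt h_small j).const_mul ((j : ℝ) + 1)
  refine squeeze_zero_norm' ?_ hlim
  have hall : ∀ᶠ i in atTop, ∀ t ∈ Finset.range (j + 1), (cyclicNB (G i) (t + 1)).card ^ 2 ≤ n i :=
    (Filter.eventually_all_finset _).2 fun t _ => hC t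
  filter_upwards [hall, hd.eventually_ge_atTop 1, hn.eventually_gt_atTop 0] with i hi hdi hni
  have hn0 : (0 : ℝ) < n i := by exact_mod_cast hni
  have hd1 : (1 : ℝ) ≤ d i := by exact_mod_cast hdi
  have hdeg : ∀ w, (G i).degree w ≤ d i := by
    intro w
    cases w with
    | inl u => rw [(hG i).degree_of_side_eq_one _ rfl]; exact hld i
    | inr v => rw [(hG i).degree_of_side_eq_zero _ rfl]
  have h1 := card_closedNB_le (G i) hdeg hdi (Nat.sqrt (n i)) j fun t ht =>
    Nat.le_sqrt'.2 (hi t (Finset.mem_range.2 (by omega)))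
  have h2 : |nbTrace (G i) side 0 (j + 1)| ≤ ((j : ℝ) + 1) * d i ^ (j + 1) * Real.sqrt (n i) := by
    calc _ ≤ ((closedNB (G i) (j + 1)).card : ℝ) := abs_nbTrace_zero_le _ _ _
      _ ≤ (((j + 1) * d i ^ (j + 1) * Nat.sqrt (n i) : ℕ) : ℝ) := by exact_mod_cast h1
      _ ≤ _ := by
        push_cast
        gcongr
        exact Real.nat_sqrt_le_real_sqrt
  have hs1 : 1 ≤ Real.sqrt (d i) ^ (j + 1) := one_le_pow₀ (Real.one_le_sqrt.2 hd1)
  rw [Real.norm_eq_abs, abs_div, abs_of_pos (show (0 : ℝ) < n i * Real.sqrt (d i) ^ (j + 1) by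
    positivity)]
  calc _ ≤ |nbTrace (G i) side 0 (j + 1)| / n i := by
        gcongr
        exact le_mul_of_one_le_right hn0.le hs1
    _ ≤ ((j : ℝ) + 1) * d i ^ (j + 1) * Real.sqrt (n i) / n i := by gcongr
    _ = _ := by
        nth_rewrite 2 [← Real.sq_sqrt hn0.le]
        have := (Real.sqrt_pos.2 hn0).ne'
        field_simp

end Limit

/-! ### Borel–Cantelli. -/

section AlmostSure

open BiregularMP MeasureTheory

theorem summable_inv_sq_mul_inv_sq :
    Summable fun q : ℕ × ℕ => (((q.1 : ℝ) + 1) ^ 2)⁻¹ * (((q.2 : ℝ) + 1) ^ 2)⁻¹ := by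
  have h : Summable fun a : ℕ => (((a : ℝ) + 1) ^ 2)⁻¹ := by
    have := (summable_nat_add_iff 1).2 (Real.summable_nat_pow_inv.2 (show 1 < 2 by norm_num))
    simpa using this
  exact Summable.mul_of_nonneg h h (fun _ => by positivity) fun _ => by positivity

theorem eventually_pow_le {n d : ℕ → ℕ} (hd : Tendsto d atTop atTop)
    (h_small : ∀ ε : ℝ, 0 < ε →
      (fun i => (d i : ℝ)) =o[atTop] fun i => (n i : ℝ) ^ ε) (K : ℕ) (hK : 0 < K) :
    ∀ᶠ i in atTop, (K + 4 * d i) ^ K ≤ n i := by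
  have hK0 : (0 : ℝ) < K := by exact_mod_cast hK
  -- The constant is `5` because `K + 4 d ≤ 5 d` once `d ≥ K`.
  have h := (h_small (1 / K) (by positivity)).def (show (0 : ℝ) < 5⁻¹ by norm_num)
  filter_upwards [h, hd.eventually_ge_atTop K] with i hi hKd
  rw [Real.norm_of_nonneg (Nat.cast_nonneg _), Real.norm_of_nonneg (by positivity)] at hi
  have h5 : (5 * d i : ℝ) ^ K ≤ n i := by
    calc (5 * d i : ℝ) ^ K ≤ ((n i : ℝ) ^ (1 / K : ℝ)) ^ K := by
          gcongr
          linarith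
      _ = n i := by
          rw [← Real.rpow_natCast, ← Real.rpow_mul (Nat.cast_nonneg _),
            one_div_mul_cancel hK0.ne', Real.rpow_one]
  have h6 : (5 * d i) ^ K ≤ n i := by exact_mod_cast h5
  exact (Nat.pow_le_pow_left (by omega) K).trans h6

theorem eventually_linear_lt {n d : ℕ → ℕ} (hn : Tendsto n atTop atTop)
    (h_small : ∀ ε : ℝ, 0 < ε →
      (fun i => (d i : ℝ)) =o[atTop] fun i => (n i : ℝ) ^ ε) (K : ℕ) :
    ∀ᶠ i in atTop, 4 * d i + K < n i := by
  have h := (h_small 1 one_pos).def (show (0 : ℝ) < 8⁻¹ by norm_num)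
  filter_upwards [h, hn.eventually_gt_atTop (2 * K)] with i hi hKn
  rw [Real.norm_of_nonneg (Nat.cast_nonneg _), Real.norm_of_nonneg (by positivity),
    Real.rpow_one] at hi
  have : 8 * d i ≤ n i := by
    have : (8 * d i : ℝ) ≤ n i := by linarith
    exact_mod_cast this
  omega

variable {Ω : Type*} [MeasurableSpace Ω] {P : Measure Ω}
  {m n l d : ℕ → ℕ} {y : ℝ} {G : (i : ℕ) → Ω → SimpleGraph (Fin (m i) ⊕ Fin (n i))}

theorem measure_hasLaw_uniformBiregular_le {m n l d : ℕ}
    {G : Ω → SimpleGraph (Fin m ⊕ Fin n)}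
    (hG : ProbabilityTheory.HasLaw G (uniformBiregular m n l d) P)
    (S : Set (SimpleGraph (Fin m ⊕ Fin n))) :
    P {ω | G ω ∈ S} ≤ uniformBiregular m n l d S := by
  rw [← hG.map_eq]
  exact Measure.le_map_apply hG.aemeasurable S

theorem ae_isBiregular {m n l d : ℕ} {G : Ω → SimpleGraph (Fin m ⊕ Fin n)}
    (hG : ProbabilityTheory.HasLaw G (uniformBiregular m n l d) P) :
    ∀ᵐ ω ∂P, IsBiregular l d (G ω) := by
  classical
  have h := measure_hasLaw_uniformBiregular_le hG {G | ¬ IsBiregular l d G}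
  rw [uniformBiregular_apply] at h
  have h0 : ((biregularSets (Fin m) (Fin n) l d).filter
      fun H => graphOfEdges H ∈ {G | ¬ IsBiregular l d G}) = ∅ := by
    rw [Finset.filter_eq_empty_iff]
    intro H hH hH'
    exact hH' ((isBiregular_graphOfEdges H).2 hH)
  rw [h0] at h
  rw [ae_iff]
  simpa using h

/-- Several indices may share the same `n`, so summability comes from the distinct pairs: `m` is at
most `(y + 1) n` eventually, and `n⁻⁴` is dominated by a multiple of `(m + 1)⁻² (n + 1)⁻²`, summable
over all pairs. -/
theorem ae_eventually_card_cyclicNB_sq_le [IsProbabilityMeasure P]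
    (h_sizes : Function.Injective fun i => (m i, n i))
    (hn : Tendsto n atTop atTop) (hld : ∀ i, l i ≤ d i) (hd : Tendsto d atTop atTop)
    (h_small : ∀ ε : ℝ, 0 < ε →
      (fun i => (d i : ℝ)) =o[atTop] fun i => (n i : ℝ) ^ ε)
    (h_ratio : Tendsto (fun i => (d i : ℝ) / (l i : ℝ)) atTop (𝓝 y)) (hy : 1 ≤ y)
    (hG : ∀ i, ProbabilityTheory.HasLaw (G i) (uniformBiregular (m i) (n i) (l i) (d i)) P)
    (j : ℕ) :
    ∀ᵐ ω ∂P, ∀ᶠ i in atTop, (cyclicNB (G i ω) (j + 1)).card ^ 2 ≤ n i := by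
  have hbip : ∀ i, m i * l i = n i * d i := by
    intro i
    obtain ⟨ω, hω⟩ := (ae_isBiregular (hG i)).exists
    exact hω.card_mul_eq
  have hev : ∀ᶠ i in atTop, P {ω | n i < (cyclicNB (G i ω) (j + 1)).card ^ 2} ≤
      ENNReal.ofReal (4 * (y + 2) ^ 2 *
        ((((m i : ℝ) + 1) ^ 2)⁻¹ * (((n i : ℝ) + 1) ^ 2)⁻¹)) := by
    filter_upwards [eventually_pow_le hd h_small (10 * (j + 1 + 1)) (by omega),
      eventually_linear_lt hn h_small (2 * (10 * (j + 1 + 1))), hd.eventually_gt_atTop 0,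
      h_ratio.eventually_lt_const (show y < y + 1 by linarith),
      h_ratio.eventually_const_lt (show 0 < y by linarith)] with i h1 h2 h3 h4 h5
    refine (measure_hasLaw_uniformBiregular_le (hG i)
      {G | n i < (cyclicNB G (j + 1)).card ^ 2}).trans ?_
    refine (uniformBiregular_card_cyclicNB_le (Nat.succ_pos j) (hld i) h3 (hbip i) h2 h1).trans ?_
    refine ENNReal.ofReal_le_ofReal ?_
    have hl0 : (0 : ℝ) < l i := by
      rcases Nat.eq_zero_or_pos (l i) with h | h
      · simp [h] at h5
      · exact_mod_cast h
    have hn1 : (1 : ℝ) ≤ n i := by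
      have : 1 ≤ n i := by omega
      exact_mod_cast this
    have hm : (m i : ℝ) ≤ n i * (y + 1) := by
      have e : (m i : ℝ) * l i = n i * d i := by exact_mod_cast hbip i
      rw [div_lt_iff₀ hl0] at h4
      refine le_of_mul_le_mul_right ?_ hl0
      rw [e, mul_assoc]
      gcongr
    rw [← mul_inv, ← div_eq_mul_inv, inv_eq_one_div, div_le_div_iff₀ (by positivity) (by positivity),
      one_mul]
    have e1 : (m i : ℝ) + 1 ≤ (y + 2) * n i := by linarith
    have e2 : (n i : ℝ) + 1 ≤ 2 * n i := by linarith
    calc ((m i : ℝ) + 1) ^ 2 * ((n i : ℝ) + 1) ^ 2 ≤ ((y + 2) * n i) ^ 2 * (2 * n i) ^ 2 := by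
          gcongr
      _ = _ := by ring
  obtain ⟨i₀, hi₀⟩ := eventually_atTop.1 hev
  -- Putting `i₀ ≤ i` into the event empties the early terms, for which there is no bound.
  have hsum : ∑' i, P {ω | i₀ ≤ i ∧ n i < (cyclicNB (G i ω) (j + 1)).card ^ 2} ≠ ⊤ := by
    have hs := ((summable_inv_sq_mul_inv_sq.comp_injective h_sizes).mul_left
      (4 * (y + 2) ^ 2)).tsum_ofReal_ne_top
    refine ne_top_of_le_ne_top hs (ENNReal.tsum_le_tsum fun i => ?_)
    by_cases hi : i₀ ≤ i
    · simp only [hi, true_and]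
      exact hi₀ i hi
    · simp [hi]
  filter_upwards [ae_eventually_notMem hsum] with ω hω
  filter_upwards [hω, eventually_ge_atTop i₀] with i hi hi'
  by_contra h
  exact hi ⟨hi', not_le.1 h⟩

end AlmostSure

/-! ### Conclusion. -/

theorem proposition7
    {Ω : Type*} [MeasurableSpace Ω] (P : MeasureTheory.Measure Ω)
    [MeasureTheory.IsProbabilityMeasure P]
    (m n dL dR : ℕ → ℕ) (y : ℝ)
    (h_sizes : Function.Injective fun i => (m i, n i))
    (h_n : Filter.Tendsto n Filter.atTop Filter.atTop)
    (h_le : ∀ i, dL i ≤ dR i)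
    (h_dR : Filter.Tendsto dR Filter.atTop Filter.atTop)
    (h_small : ∀ ε : ℝ, 0 < ε →
      (fun i => (dR i : ℝ)) =o[Filter.atTop] fun i => (n i : ℝ) ^ ε)
    (h_ratio : Filter.Tendsto (fun i => (dR i : ℝ) / (dL i : ℝ)) Filter.atTop (nhds y))
    (hy : 1 ≤ y)
    (G : (i : ℕ) → Ω → SimpleGraph (Fin (m i) ⊕ Fin (n i)))
    (hG : ∀ i, ProbabilityTheory.HasLaw (G i)
      (BiregularMP.uniformBiregular (m i) (n i) (dL i) (dR i)) P) :
    (∀ᵐ ω ∂P,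
      (∀ k : ℕ, Filter.Tendsto
        (fun i => ∫ x, x ^ (2 * k + 1)
          ∂(BiregularMP.esd (BiregularMP.scaledAdj_isHermitian (dR i) (G i ω))))
        Filter.atTop (nhds 0)) ∧
      (∀ k : ℕ, 1 ≤ k → Filter.Tendsto
        (fun i => ∫ x, x ^ (2 * k)
          ∂(BiregularMP.esd (BiregularMP.scaledAdj_isHermitian (dR i) (G i ω))))
        Filter.atTop (nhds (2 / (1 + y) * BiregularMP.mpMoment k y⁻¹ 1)))) ∧
    (∀ k : ℕ, 1 ≤ k → BiregularMP.mpMoment k y⁻¹ 1 =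
      ∑ r ∈ Finset.range k, y⁻¹ ^ r * BiregularMP.narayana k r) := by
  have hy0 : y ≠ 0 := by linarith
  have hc0 : 0 < y⁻¹ := by positivity
  have hc1 : y⁻¹ ≤ 1 := inv_le_one_of_one_le₀ hy
  have hmp : ∀ k : ℕ, BiregularMP.mpMoment (k + 1) y⁻¹ 1 =
      ∑ r ∈ Finset.range (k + 1), y⁻¹ ^ r * BiregularMP.narayana (k + 1) r :=
    mpMoment_eq_sum_narayana hc0 hc1
  have hc : Tendsto (fun i => (dL i : ℝ) / (dR i : ℝ)) atTop (𝓝 y⁻¹) := by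
    simpa using h_ratio.inv₀ hy0
  refine ⟨?_, fun k hk => ?_⟩
  · filter_upwards [MeasureTheory.ae_all_iff.2 fun i => ae_isBiregular (hG i),
      MeasureTheory.ae_all_iff.2 fun j =>
        ae_eventually_card_cyclicNB_sq_le h_sizes h_n h_le h_dR h_small h_ratio hy hG j]
      with ω hω hC
    refine ⟨fun k => ?_, fun k hk => ?_⟩
    · simp_rw [integral_pow_odd_esd_scaledAdj (hω _)]
      exact tendsto_const_nhds
    · obtain ⟨k, rfl⟩ : ∃ k', k = k' + 1 := ⟨k - 1, by omega⟩
      have h0 := tendsto_nbTrace_zero_of_cyclicNB (fun i => G i ω) hω h_le h_dR h_n h_small hC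
      have hlim := tendsto_nbTrace (fun i => G i ω) hω h_dR h_n hc h0 (2 * (k + 1)) 0
      rw [alternatingPaths_eq_sum_narayana hc0.ne', ← hmp] at hlim
      -- The trace is twice its part over `R`, normalised by `m + n` instead of `n`; counting edges
      -- gives `m = n dR / dL`, so the factor is `2 n / (m + n)`.
      have hfrac : Tendsto (fun i => 2 / (1 + (dR i : ℝ) / (dL i : ℝ))) atTop
          (𝓝 (2 / (1 + y))) :=
        tendsto_const_nhds.div (tendsto_const_nhds.add h_ratio) (by linarith)
      refine (hfrac.mul hlim).congr' ?_
      filter_upwards [h_n.eventually_gt_atTop 0, h_dR.eventually_gt_atTop 0,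
        h_ratio.eventually_const_lt (show 0 < y by linarith)] with i hni hdi hi
      rw [integral_pow_even_esd_scaledAdj (hω i)]
      have hn0 : (0 : ℝ) < n i := by exact_mod_cast hni
      have hd0 : (0 : ℝ) < dR i := by exact_mod_cast hdi
      have hl0 : (0 : ℝ) < dL i := by
        rcases Nat.eq_zero_or_pos (dL i) with h | h
        · simp [h] at hi
        · exact_mod_cast h
      have hs0 := Real.sqrt_pos.2 hd0
      have hm : (m i : ℝ) = n i * dR i / dL i := by
        rw [eq_div_iff hl0.ne']
        exact_mod_cast (hω i).card_mul_eq
      rw [hm, add_zero, inv_pow]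
      field_simp
      ring
  · obtain ⟨k, rfl⟩ : ∃ k', k = k' + 1 := ⟨k - 1, by omega⟩
    exact hmp k
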